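/- Let $p\ge 1$ and let $(\varepsilon_n)_{n\ge1}$ be i.i.d. real random variables with $\mathbf E\varepsilon_1=0$ and $0<\mathbf E\varepsilon_1^2=\sigma^2<\infty$, whose law does not depend on $\theta$. For $\theta=(\theta_1,\dots,\theta_p)'\in\mathbb R^p$ let $x_n=\theta_1x_{n-1}+\dots+\theta_px_{n-p}+\varepsilon_n$ for $n\ge1$, with $x_0=x_{-1}=\dots=x_{1-p}=0$; let $\mathbf P_\theta$ denote probability for the process with parameter $\theta$. Put $X_n=(x_n,x_{n-1},\dots,x_{n-p+1})'$ and $M_n=\sum_{k=1}^nX_{k-1}X_{k-1}'$. Let $\tilde\Lambda_p$ be the set of all $\theta\in\mathbb R^p$ such that: 1. all complex roots of $\mathcal P(z)=z^p-\theta_1z^{p-1}-\dots-\theta_p$ satisfy $|z|\le1$; 2. all roots of $\mathcal P$ with $|z|=1$ are simple; 3. the linear system in $Y_1,\dots,Y_{p-1}$ $$-\sum_{k=1}^{j-1}\theta_{j-k}Y_k+Y_j-\sum_{k=1}^{p-j}\theta_{k+j}Y_k=\theta_j,\qquad 1\le j\le p-1,$$ has a unique solution $Y_i=\kappa_i(\theta)$,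 and the $p\times p$ symmetric Toeplitz matrix $L(\theta)$ with $L(\theta)_{ii}=1$ and $L(\theta)_{ij}=\kappa_{|i-j|}(\theta)$ for $i\ne j$ is positive definite. (For $p=1$ the system is empty and $L(\theta)=(1)$.) Then for every compact set $K\subset\tilde\Lambda_p$ and every $\delta>0$, $$\lim_{m\to\infty}\ \sup_{\theta\in K}\ \mathbf P_\theta\left(\left\|\frac{M_n}{\sum_{k=1}^nx_{k-1}^2}-L(\theta)\right\|\ge\delta\ \text{ for some } n\ge m\right)=0,$$ where $\|\cdot\|$ is the Frobenius norm (equivalently, any fixed norm on $p\times p$ matrices), and the quotient is read as the zero matrix when its denominator vanishes. -/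

import Mathlib

open MeasureTheory ProbabilityTheory Filter Topology
open scoped Matrix.Norms.Frobenius

namespace ARModel

/-- One-based access to the coordinates of a vector: `coord v r` is `v_r` for `1 ≤ r ≤ q`
(and `0` outside this range, which the formulas below never reach). -/
def coord {q : ℕ} (v : Fin q → ℝ) (r : ℕ) : ℝ :=
  if h : 1 ≤ r ∧ r ≤ q then v ⟨r - 1, by omega⟩ else 0

/-- The values `x_0, x_1, x_2, …` of the autoregression. The truncated subtraction sends every
nonpositive time to time `0`, where the value is `0`, as it is at all presample times. -/
noncomputable def arNat {p : ℕ} (θ : Fin p → ℝ) (e : ℕ → ℝ) : ℕ → ℝ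
  | 0 => 0
  | n + 1 => (∑ l : Fin p, θ l * arNat θ e (n - (l : ℕ))) + e (n + 1)

/-- The path of the AR(p) process with parameter `θ` driven by the noise path `e_1, e_2, …`,
indexed by all integer times; `x_n = 0` for `n ≤ 0`. -/
noncomputable def ar {p : ℕ} (θ : Fin p → ℝ) (e : ℕ → ℝ) (n : ℤ) : ℝ :=
  arNat θ e n.toNat

theorem ar_nonpos {p : ℕ} (θ : Fin p → ℝ) (e : ℕ → ℝ) {n : ℤ} (hn : n ≤ 0) :
    ar θ e n = 0 := by
  have h : n.toNat = 0 := by omega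
  rw [ar, h, arNat]

/-- `x_n = θ_1 x_{n-1} + … + θ_p x_{n-p} + e_n` for `n ≥ 1`. -/
theorem ar_rec {p : ℕ} (θ : Fin p → ℝ) (e : ℕ → ℝ) {n : ℕ} (hn : 1 ≤ n) :
    ar θ e n = (∑ l ∈ Finset.Icc 1 p, coord θ l * ar θ e ((n : ℤ) - (l : ℤ))) + e n := by
  obtain ⟨k, rfl⟩ : ∃ k, n = k + 1 := ⟨n - 1, by omega⟩
  have h1 : ar θ e ((k + 1 : ℕ) : ℤ) = arNat θ e (k + 1) := by
    rw [ar, Int.toNat_natCast]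
  rw [h1, arNat]
  congr 1
  have h2 : ∑ l ∈ Finset.Icc 1 p, coord θ l * ar θ e (((k + 1 : ℕ) : ℤ) - (l : ℤ)) =
      ∑ l ∈ Finset.range p, coord θ (l + 1) * ar θ e (((k + 1 : ℕ) : ℤ) - ((l + 1 : ℕ) : ℤ)) := by
    rw [Finset.range_eq_Ico, Finset.sum_Ico_add'
      (fun l : ℕ => coord θ l * ar θ e (((k + 1 : ℕ) : ℤ) - (l : ℤ))) 0 p 1]
    rfl
  rw [h2, Finset.sum_range]
  refine Finset.sum_congr rfl fun l _ => ?_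
  have h3 : coord θ ((l : ℕ) + 1) = θ l := by
    have := l.isLt
    rw [coord, dif_pos ⟨by omega, by omega⟩]
    rfl
  have h4 : (((k + 1 : ℕ) : ℤ) - (((l : ℕ) + 1 : ℕ) : ℤ)).toNat = k - (l : ℕ) := by omega
  rw [h3, ar, h4]

/-- The state vector `X_n = (x_n, x_{n-1}, …, x_{n-p+1})'`. -/
noncomputable def stateVec {p : ℕ} (θ : Fin p → ℝ) (e : ℕ → ℝ) (n : ℤ) : Fin p → ℝ :=
  fun i => ar θ e (n - ((i : ℕ) : ℤ))

/-- The observed Fisher information matrix `M_n = ∑_{k=1}^n X_{k-1} X_{k-1}'`. -/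
noncomputable def fisher {p : ℕ} (θ : Fin p → ℝ) (e : ℕ → ℝ) (n : ℕ) :
    Matrix (Fin p) (Fin p) ℝ :=
  ∑ k ∈ Finset.Icc 1 n,
    Matrix.vecMulVec (stateVec θ e ((k : ℤ) - 1)) (stateVec θ e ((k : ℤ) - 1))

/-- `∑_{k=1}^n x_{k-1}²`. -/
noncomputable def sumSq {p : ℕ} (θ : Fin p → ℝ) (e : ℕ → ℝ) (n : ℕ) : ℝ :=
  ∑ k ∈ Finset.Icc 1 n, (ar θ e ((k : ℤ) - 1)) ^ 2

/-- The characteristic polynomial `z^p - θ_1 z^{p-1} - … - θ_p`, over the complex numbers. -/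
noncomputable def charPoly {p : ℕ} (θ : Fin p → ℝ) : Polynomial ℂ :=
  Polynomial.X ^ p -
    ∑ l ∈ Finset.Icc 1 p, Polynomial.C ((coord θ l : ℝ) : ℂ) * Polynomial.X ^ (p - l)

/-- All roots of the characteristic polynomial lie inside or on the unit circle. -/
def Condition1 {p : ℕ} (θ : Fin p → ℝ) : Prop :=
  ∀ z : ℂ, (charPoly θ).IsRoot z → ‖z‖ ≤ 1

/-- All roots of modulus one of the characteristic polynomial are simple. -/
def Condition2 {p : ℕ} (θ : Fin p → ℝ) : Prop :=
  ∀ z : ℂ, (charPoly θ).IsRoot z → ‖z‖ = 1 → (charPoly θ).rootMultiplicity z = 1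

/-- The linear system for `Y_1, …, Y_{p-1}`: for `1 ≤ j ≤ p - 1`,
`-∑_{k=1}^{j-1} θ_{j-k} Y_k + Y_j - ∑_{k=1}^{p-j} θ_{k+j} Y_k = θ_j`
(for `j = 1` the first sum is empty). -/
def IsSolution {p : ℕ} (θ : Fin p → ℝ) (Y : Fin (p - 1) → ℝ) : Prop :=
  ∀ j ∈ Finset.Icc 1 (p - 1),
    -(∑ k ∈ Finset.Icc 1 (j - 1), coord θ (j - k) * coord Y k) + coord Y j
      - (∑ k ∈ Finset.Icc 1 (p - j), coord θ (k + j) * coord Y k) = coord θ j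

/-- `κ(θ) = (κ_1(θ), …, κ_{p-1}(θ))`, a solution of the system (the solution, whenever it is
unique; an irrelevant value if there is no solution). -/
noncomputable def kappa {p : ℕ} (θ : Fin p → ℝ) : Fin (p - 1) → ℝ :=
  Classical.epsilon (IsSolution θ)

/-- The symmetric Toeplitz matrix `L(θ)`, with `1` on the diagonal and `κ_{|i-j|}(θ)` off it. -/
noncomputable def limitMatrix {p : ℕ} (θ : Fin p → ℝ) : Matrix (Fin p) (Fin p) ℝ :=
  Matrix.of fun i j =>
    if i = j then 1 else coord (kappa θ) (((i : ℕ) : ℤ) - ((j : ℕ) : ℤ)).natAbs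

/-- The system has a unique solution, and the matrix `L(θ)` is positive definite. -/
def Condition3 {p : ℕ} (θ : Fin p → ℝ) : Prop :=
  (∃! Y : Fin (p - 1) → ℝ, IsSolution θ Y) ∧ (limitMatrix θ).PosDef

/-- The set of all parameter vectors that satisfy the three conditions. -/
def tildeLambda (p : ℕ) : Set (Fin p → ℝ) :=
  {θ | Condition1 θ ∧ Condition2 θ ∧ Condition3 θ}

end ARModel

/-! Write S_n for `∑_{k≤n} x_{k-1}²`. The entries of M_n/S_n are normalized lagged products. Raising
both lags by one removes a single product of recent values, so M_n/S_n is nearly Toeplitz as soon as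
x_{n-i}² (i ≤ p) is negligible against S_n. Multiplying the recursion by x_{k-j} and summing then
shows that the off-diagonal values nearly solve the linear system of condition 3; the only further
error is T_j/S_n with `T_j = ∑ x_{k-j} ε_k`. Unique solvability and compactness of K make the system
uniformly well conditioned (`exists_abs_sub_kappa_le`), whence closeness to L(θ)
(`exists_norm_sub_limitMatrix_lt`).

It remains to make both errors small uniformly in θ.

The recent values are handled pathwise (`exists_sumSq_bounds`). By conditions 1 and 2 and
compactness, roots near the unit circle stay apart from the other roots, so the recursion is stable
with one constant for all of K (`exists_abs_ar_le`). Restarting it from J different blocks and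
averaging bounds x_n² by a multiple of S_n/J plus noise energy in a short window. The noise energy
grows linearly, which forces S_n to grow at least linearly and makes the window negligible. The only
random input is the law of large numbers for ε_k², an event free of θ.

For T_j, dividing each weight by A plus the running sum of squared weights gives a martingale
transform with total squared weight at most 1/A. Kolmogorov's inequality controls it for all n at
once, with a bound free of θ, and summation by parts returns to T_j (`measure_correlation_le`). -/

namespace ARModel

/-! ### Linear recurrences with roots in the closed unit disc -/

/-- The shift operator on complex sequences. -/
def seqShift : Module.End ℂ (ℕ → ℂ) where
  toFun x n := x (n + 1)
  map_add' _ _ := rfl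
  map_smul' _ _ := rfl

theorem seqShift_pow_apply (k : ℕ) (x : ℕ → ℂ) (n : ℕ) : (seqShift ^ k) x n = x (n + k) := by
  induction k generalizing n with
  | zero => rfl
  | succ k ih =>
    rw [pow_succ', Module.End.mul_apply]
    change (seqShift ^ k) x (n + 1) = _
    rw [ih, add_right_comm, add_assoc]

/-- Solutions of a linear recurrence whose roots `z` lie in the closed unit disc, the roots close
to the unit circle being separated from the others, are bounded in terms of their initial values
and the inhomogeneous term. -/
theorem norm_le_of_aeval_seqShift {ι : Type*} [DecidableEq ι] {η : ℝ} (hη : 0 < η) (z : ι → ℂ)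
    (hz : ∀ l, ‖z l‖ ≤ 1) (hsep : ∀ k l, k ≠ l → η ≤ ‖z k - z l‖ + (1 - ‖z k‖)) (d : ℕ) :
    ∀ (s : Finset ι), s.card = d → ∀ (x f : ℕ → ℂ) (b : ℝ), 0 ≤ b → (∀ i < d, ‖x i‖ ≤ b) →
      Polynomial.aeval seqShift (∏ l ∈ s, (Polynomial.X - Polynomial.C (z l))) x = f →
      ∀ n, ‖x n‖ ≤ (1 + 8 / η) ^ d * (b + ∑ i ∈ Finset.range (n + 1), ‖f i‖) := by
  induction d with
  | zero =>
    intro s hs x f b hb _ hx n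
    rw [Finset.card_eq_zero] at hs
    subst hs
    simp only [Finset.prod_empty, map_one, Module.End.one_apply] at hx
    subst hx
    have := Finset.single_le_sum (f := fun i => ‖x i‖) (s := Finset.range (n + 1))
      (fun i _ => norm_nonneg _) (Finset.mem_range.2 (Nat.lt_succ_self n))
    simp only [pow_zero, one_mul]
    linarith
  | succ d ih =>
    intro s hs x f b hb hxb hx n
    set C := (1 + 8 / η) ^ d with hC
    have h8 : 0 < 8 / η := by positivity
    have hC1 : 1 ≤ C := one_le_pow₀ (by linarith)
    set F : ℕ → ℝ := fun n => ∑ i ∈ Finset.range (n + 1), ‖f i‖ with hF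
    have hF0 : ∀ n, 0 ≤ F n := fun n => Finset.sum_nonneg fun i _ => norm_nonneg _
    have hFs : ∀ n, F (n + 1) = F n + ‖f (n + 1)‖ := fun n => Finset.sum_range_succ _ _
    -- Applying the factor `S - z k` (`S` the shift) to `x` leaves a recurrence of degree `d` with
    -- the same right-hand side; its initial values are at most `2 * b`.
    have hred : ∀ k ∈ s, Polynomial.aeval seqShift
        (∏ l ∈ s.erase k, (Polynomial.X - Polynomial.C (z l)))
        (fun n => x (n + 1) - z k * x n) = f := by
      intro k hk
      rw [← hx, ← Finset.prod_erase_mul _ _ hk, map_mul, Module.End.mul_apply]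
      congr 1
      simp only [map_sub, Polynomial.aeval_X, Polynomial.aeval_C]
      rfl
    have hstep : ∀ k ∈ s, ∀ n, ‖x (n + 1) - z k * x n‖ ≤ 2 * C * (b + F n) := by
      intro k hk n
      have h1 := ih (s.erase k) (by rw [Finset.card_erase_of_mem hk, hs]; rfl)
        (fun n => x (n + 1) - z k * x n) f (2 * b) (by linarith) (by
          intro i hi
          calc ‖x (i + 1) - z k * x i‖ ≤ ‖x (i + 1)‖ + ‖z k * x i‖ := norm_sub_le _ _
            _ ≤ b + 1 * b := by
              rw [norm_mul]
              gcongr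
              · exact hxb _ (by omega)
              · exact hz k
              · exact hxb _ (by omega)
            _ = 2 * b := by ring) (hred k hk) n
      have h2 : C * (2 * b + F n) ≤ 2 * C * (b + F n) := by
        nlinarith [hF0 n, mul_nonneg (by linarith : (0:ℝ) ≤ C) (hF0 n)]
      exact h1.trans h2
    have hbF : 0 ≤ b + F n := by linarith [hF0 n]
    obtain ⟨k, hk⟩ : s.Nonempty := Finset.card_pos.1 (by omega)
    change ‖x n‖ ≤ _ * (b + F n)
    rw [pow_succ, ← hC]
    -- With two well-separated roots, `x` is recovered from the two reduced sequences by dividing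
    -- their difference by `z k - z l`, so no sum over time is needed.
    by_cases h1 : ∃ l ∈ s, η / 2 ≤ ‖z k - z l‖
    · obtain ⟨l, hl, hkl⟩ := h1
      have h2 : ‖z k - z l‖ * ‖x n‖ ≤ 4 * C * (b + F n) := by
        rw [← norm_mul]
        calc ‖(z k - z l) * x n‖
            = ‖(x (n + 1) - z l * x n) - (x (n + 1) - z k * x n)‖ := by congr 1; ring
          _ ≤ 2 * C * (b + F n) + 2 * C * (b + F n) :=
            (norm_sub_le _ _).trans (add_le_add (hstep l hl n) (hstep k hk n))
          _ = _ := by ring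
      have h3 : η / 2 * ‖x n‖ ≤ 4 * C * (b + F n) :=
        (mul_le_mul_of_nonneg_right hkl (norm_nonneg _)).trans h2
      have h4 : ‖x n‖ ≤ 8 / η * (C * (b + F n)) := by
        rw [div_mul_eq_mul_div, le_div_iff₀ hη]; linarith
      have h5 : 0 ≤ C * (b + F n) := by positivity
      calc ‖x n‖ ≤ _ := h4
        _ ≤ 8 / η * (C * (b + F n)) + C * (b + F n) := by linarith
        _ = _ := by ring
    · push Not at h1
      have hCb : b + F n ≤ C * (1 + 8 / η) * (b + F n) := by
        have : 1 ≤ C * (1 + 8 / η) := by nlinarith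
        nlinarith
      -- Otherwise all roots cluster around `z k`. A lone root may lie on the unit circle, since
      -- first-order recursion only adds up `f`; a second root nearby forces `z k` strictly inside
      -- the disc, by `hsep`.
      by_cases h2 : s = {k}
      · refine le_trans ?_ hCb
        have hy : ∀ n, x (n + 1) - z k * x n = f n := by
          intro n
          have := hred k hk
          rw [h2] at this
          simp only [Finset.erase_singleton, Finset.prod_empty, map_one,
            Module.End.one_apply] at this
          exact congrFun this n
        have : ∀ n, ‖x n‖ ≤ b + ∑ i ∈ Finset.range n, ‖f i‖ := by
          intro n
          induction n with
          | zero => simpa using hxb 0 (by omega)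
          | succ n ihn =>
            rw [Finset.sum_range_succ, ← hy n]
            calc ‖x (n + 1)‖ = ‖z k * x n + (x (n + 1) - z k * x n)‖ := by congr 1; ring
              _ ≤ ‖z k * x n‖ + ‖x (n + 1) - z k * x n‖ := norm_add_le _ _
              _ ≤ _ := by
                rw [norm_mul]
                nlinarith [hz k, norm_nonneg (x n)]
        refine (this n).trans ?_
        simp only [hF, Finset.sum_range_succ]
        linarith [norm_nonneg (f n)]
      · obtain ⟨l, hl, hlk⟩ : ∃ l ∈ s, l ≠ k := by
          by_contra! h
          exact h2 (Finset.eq_singleton_iff_unique_mem.2 ⟨hk, h⟩)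
        have hzk : ‖z k‖ ≤ 1 - η / 2 := by
          have := hsep k l hlk.symm
          have := h1 l hl
          linarith
        have : ∀ n, ‖x n‖ ≤ b + 4 * C / η * (b + F n) := by
          intro n
          induction n with
          | zero =>
            have := hxb 0 (by omega)
            have : 0 ≤ 4 * C / η * (b + F 0) := by have := hF0 0; positivity
            linarith
          | succ n ihn =>
            have h6 := hstep k hk n
            have h7 : ‖x (n + 1)‖ ≤ ‖z k‖ * ‖x n‖ + ‖x (n + 1) - z k * x n‖ := by
              calc ‖x (n + 1)‖ = ‖z k * x n + (x (n + 1) - z k * x n)‖ := by congr 1; ring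
                _ ≤ ‖z k * x n‖ + ‖x (n + 1) - z k * x n‖ := norm_add_le _ _
                _ = _ := by rw [norm_mul]
            have h0 : 0 ≤ b + F n := by linarith [hF0 n]
            have h8 : ‖z k‖ * ‖x n‖ ≤ (1 - η / 2) * (b + 4 * C / η * (b + F n)) :=
              mul_le_mul hzk ihn (norm_nonneg _) ((norm_nonneg _).trans hzk)
            -- The factor `4 * C / η` is chosen so that the contraction gains `η / 2 * (4 * C / η) =
            -- 2 * C`, exactly the forcing in `hstep`.
            have h9 : (1 - η / 2) * (b + 4 * C / η * (b + F n)) + 2 * C * (b + F n)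
                = b - η / 2 * b + 4 * C / η * (b + F n) := by
              field_simp
              ring
            have h10 : 4 * C / η * (b + F n) ≤ 4 * C / η * (b + F (n + 1)) := by
              have := hFs n
              have := norm_nonneg (f (n + 1))
              gcongr
              linarith
            have h11 : 0 ≤ η / 2 * b := by positivity
            linarith
        have h5 : b ≤ C * (b + F n) := by nlinarith [hF0 n]
        have h6 : 0 ≤ 4 * C / η * (b + F n) := by positivity
        calc ‖x n‖ ≤ _ := this n
          _ ≤ C * (b + F n) + 4 * C / η * (b + F n) + 4 * C / η * (b + F n) := by linarith
          _ = _ := by ring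

/-! ### Characteristic polynomial, root separation and uniform stability -/

theorem aeval_seqShift_charPoly {p : ℕ} (θ : Fin p → ℝ) (x : ℕ → ℂ) (n : ℕ) :
    Polynomial.aeval seqShift (charPoly θ) x n =
      x (n + p) - ∑ l ∈ Finset.Icc 1 p, ((coord θ l : ℝ) : ℂ) * x (n + (p - l)) := by
  rw [charPoly]
  simp only [map_sub, map_sum, map_mul, map_pow, Polynomial.aeval_X, Polynomial.aeval_C,
    LinearMap.sub_apply, LinearMap.sum_apply, Module.End.mul_apply, Pi.sub_apply,
    Finset.sum_apply, seqShift_pow_apply, Module.algebraMap_end_apply, Pi.smul_apply, smul_eq_mul]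

theorem continuous_coord {q : ℕ} (r : ℕ) : Continuous fun v : Fin q → ℝ => coord v r := by
  unfold coord
  split_ifs
  · fun_prop
  · fun_prop

theorem charPoly_degree_lt {p : ℕ} (θ : Fin p → ℝ) :
    (∑ l ∈ Finset.Icc 1 p, Polynomial.C ((coord θ l : ℝ) : ℂ) * Polynomial.X ^ (p - l)).degree
      < (p : WithBot ℕ) := by
  refine lt_of_le_of_lt (Polynomial.degree_sum_le _ _) ?_
  refine (Finset.sup_lt_iff (WithBot.bot_lt_coe p)).2 fun l hl => ?_
  rw [Finset.mem_Icc] at hl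
  refine lt_of_le_of_lt (Polynomial.degree_C_mul_X_pow_le _ _) ?_
  exact WithBot.coe_lt_coe.2 (by omega : p - l < p)

theorem charPoly_monic {p : ℕ} (θ : Fin p → ℝ) : (charPoly θ).Monic :=
  Polynomial.monic_X_pow_sub (charPoly_degree_lt θ)

theorem charPoly_natDegree {p : ℕ} (θ : Fin p → ℝ) : (charPoly θ).natDegree = p := by
  rw [charPoly]
  apply Polynomial.natDegree_eq_of_degree_eq_some
  rw [Polynomial.degree_sub_eq_left_of_degree_lt] <;> rw [Polynomial.degree_X_pow]
  exact charPoly_degree_lt θ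

theorem exists_charPoly_eq_prod {p : ℕ} (θ : Fin p → ℝ) :
    ∃ z : Fin p → ℂ, charPoly θ = ∏ l, (Polynomial.X - Polynomial.C (z l)) := by
  have hs := IsAlgClosed.splits (charPoly θ)
  have hcard : (charPoly θ).roots.toList.length = p := by
    rw [Multiset.length_toList, ← hs.natDegree_eq_card_roots, charPoly_natDegree]
  refine ⟨fun l => (charPoly θ).roots.toList.get (l.cast hcard.symm), ?_⟩
  have h := hs.eq_prod_roots_of_monic (charPoly_monic θ)
  conv_lhs => rw [h, ← Multiset.coe_toList (charPoly θ).roots, Multiset.map_coe, Multiset.prod_coe]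
  rw [← List.prod_ofFn]
  congr 1
  apply List.ext_get
  · simp [hcard]
  · intro n h1 h2
    simp

theorem continuous_eval_charPoly {p : ℕ} (t : ℂ) :
    Continuous fun θ : Fin p → ℝ => (charPoly θ).eval t := by
  simp only [charPoly, Polynomial.eval_sub, Polynomial.eval_finsetSum, Polynomial.eval_mul,
    Polynomial.eval_pow, Polynomial.eval_X, Polynomial.eval_C]
  refine continuous_const.sub (continuous_finsetSum _ fun l _ => ?_)
  exact (Complex.continuous_ofReal.comp (continuous_coord l)).mul continuous_const

/-- On a compact set of parameters, the roots close to the unit circle are uniformly separated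
from the other roots. -/
theorem exists_root_separation {p : ℕ} {K : Set (Fin p → ℝ)} (hK : IsCompact K)
    (h1 : ∀ θ ∈ K, Condition1 θ) (h2 : ∀ θ ∈ K, Condition2 θ) :
    ∃ η : ℝ, 0 < η ∧ ∀ θ ∈ K, ∃ z : Fin p → ℂ,
      charPoly θ = ∏ l, (Polynomial.X - Polynomial.C (z l)) ∧ (∀ l, ‖z l‖ ≤ 1) ∧
      ∀ k l, k ≠ l → η ≤ ‖z k - z l‖ + (1 - ‖z k‖) := by
  -- Compactness is applied to parameters paired with an ordered list of roots, so no continuous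
  -- choice of roots is needed; evaluating at every `t` makes the factorization a closed condition.
  set Z : Set ((Fin p → ℝ) × (Fin p → ℂ)) :=
    (K ×ˢ Set.univ.pi fun _ => Metric.closedBall 0 1) ∩
      ⋂ t : ℂ, {y | (charPoly y.1).eval t = ∏ l, (t - y.2 l)} with hZ
  have hZc : IsCompact Z := by
    refine (hK.prod (isCompact_univ_pi fun _ => isCompact_closedBall 0 1)).inter_right ?_
    refine isClosed_iInter fun t => isClosed_eq ?_ ?_
    · exact (continuous_eval_charPoly t).comp continuous_fst
    · fun_prop
  have hZprod : ∀ y ∈ Z, charPoly y.1 = ∏ l, (Polynomial.X - Polynomial.C (y.2 l)) := by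
    intro y hy
    refine Polynomial.funext fun t => ?_
    have := Set.mem_iInter.1 hy.2 t
    simpa [Polynomial.eval_prod] using this
  have hpair : ∀ kl : Fin p × Fin p, ∃ η : ℝ, 0 < η ∧ (kl.1 ≠ kl.2 → ∀ y ∈ Z,
      η ≤ ‖y.2 kl.1 - y.2 kl.2‖ + (1 - ‖y.2 kl.1‖)) := by
    rintro ⟨k, l⟩
    by_cases hkl : k = l
    · exact ⟨1, one_pos, fun h => (h hkl).elim⟩
    rcases Z.eq_empty_or_nonempty with he | hne
    · exact ⟨1, one_pos, fun _ y hy => by rw [he] at hy; exact hy.elim⟩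
    obtain ⟨y, hy, hmin⟩ := hZc.exists_isMinOn hne
      (f := fun y => ‖y.2 k - y.2 l‖ + (1 - ‖y.2 k‖)) (by fun_prop)
    refine ⟨_, ?_, fun _ y' hy' => hmin hy'⟩
    have hk1 : ‖y.2 k‖ ≤ 1 := by simpa using hy.1.2 k (Set.mem_univ _)
    -- A minimum of zero would mean that two listed roots coincide on the unit circle, contradicting
    -- simplicity.
    by_contra! hle
    have ha : ‖y.2 k - y.2 l‖ = 0 := by
      have := norm_nonneg (y.2 k - y.2 l)
      linarith
    have hb : ‖y.2 k‖ = 1 := by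
      have := norm_nonneg (y.2 k - y.2 l)
      linarith
    rw [norm_eq_zero, sub_eq_zero] at ha
    have hdvd : (Polynomial.X - Polynomial.C (y.2 k)) ^ 2 ∣ charPoly y.1 := by
      rw [hZprod y hy, ← Finset.mul_prod_erase _ _ (Finset.mem_univ k),
        ← Finset.mul_prod_erase _ _ (Finset.mem_erase.2 ⟨Ne.symm hkl, Finset.mem_univ l⟩),
        ← ha, ← mul_assoc, pow_two]
      exact dvd_mul_right _ _
    have hm := (Polynomial.le_rootMultiplicity_iff (charPoly_monic y.1).ne_zero).2 hdvd
    have hroot : (charPoly y.1).IsRoot (y.2 k) :=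
      Polynomial.dvd_iff_isRoot.1 ((dvd_pow_self _ two_ne_zero).trans hdvd)
    have := h2 y.1 hy.1.1 _ hroot hb
    omega
  choose η hη0 hη using hpair
  obtain ⟨η', hη', hle⟩ : ∃ η' : ℝ, 0 < η' ∧ ∀ kl, η' ≤ η kl := by
    rcases isEmpty_or_nonempty (Fin p × Fin p) with he | hne
    · exact ⟨1, one_pos, fun kl => he.elim kl⟩
    · obtain ⟨kl, hkl⟩ := Finite.exists_min η
      exact ⟨_, hη0 kl, hkl⟩
  refine ⟨η', hη', fun θ hθ => ?_⟩
  obtain ⟨z, hz⟩ := exists_charPoly_eq_prod θ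
  have hz1 : ∀ l, ‖z l‖ ≤ 1 := fun l => h1 θ hθ _ (by
    rw [hz, Polynomial.IsRoot, Polynomial.eval_prod]
    exact Finset.prod_eq_zero (Finset.mem_univ l) (by simp))
  refine ⟨z, hz, hz1, fun k l hkl => (hle (k, l)).trans (hη (k, l) hkl (θ, z) ⟨⟨hθ, ?_⟩, ?_⟩)⟩
  · intro l _
    simpa using hz1 l
  · refine Set.mem_iInter.2 fun t => ?_
    simp [hz, Polynomial.eval_prod]

/-- Uniform stability of the autoregression over a compact set of parameters. -/
theorem exists_abs_ar_le {p : ℕ} {K : Set (Fin p → ℝ)} (hK : IsCompact K)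
    (h1 : ∀ θ ∈ K, Condition1 θ) (h2 : ∀ θ ∈ K, Condition2 θ) :
    ∃ C : ℝ, 0 < C ∧ ∀ θ ∈ K, ∀ (e : ℕ → ℝ) (s : ℕ) (b : ℝ), 0 ≤ b → 1 ≤ s + p →
      (∀ i < p, |ar θ e (s + i : ℕ)| ≤ b) → ∀ n : ℕ,
      |ar θ e (s + n : ℕ)| ≤ C * (b + ∑ i ∈ Finset.range (n + 1), |e (s + i + p)|) := by
  obtain ⟨η, hη, h⟩ := exists_root_separation hK h1 h2
  refine ⟨(1 + 8 / η) ^ p, by positivity, fun θ hθ e s b hb hsp hinit n => ?_⟩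
  obtain ⟨z, hz, hz1, hsep⟩ := h θ hθ
  have := norm_le_of_aeval_seqShift hη z hz1 hsep p Finset.univ (by simp)
    (fun n => ((ar θ e (s + n : ℕ) : ℝ) : ℂ)) (fun i => ((e (s + i + p) : ℝ) : ℂ)) b hb
    (fun i hi => by rw [Complex.norm_real]; exact hinit i hi) (by
      rw [← hz]
      funext n
      rw [aeval_seqShift_charPoly]
      have hr := ar_rec θ e (n := s + n + p) (by omega)
      have : s + (n + p) = s + n + p := by ring
      rw [this, hr]
      push_cast
      rw [sub_eq_iff_eq_add, add_comm]
      congr 1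
      refine Finset.sum_congr rfl fun l hl => ?_
      rw [Finset.mem_Icc] at hl
      congr 3
      omega) n
  simpa only [Complex.norm_real, Real.norm_eq_abs] using this

/-! ### Energy of the process: linear growth and negligible last values -/

/-- Both sides are the sum of `g` over the times `0, …, n`. -/
theorem sum_Icc_shift (g : ℤ → ℝ) (n : ℕ) :
    ∑ k ∈ Finset.Icc 1 n, g ((k : ℤ) - 1) + g n = ∑ k ∈ Finset.Icc 1 n, g k + g 0 := by
  induction n with
  | zero => simp
  | succ n ih =>
    rw [Finset.sum_Icc_succ_top (by omega), Finset.sum_Icc_succ_top (by omega)]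
    push_cast
    rw [add_sub_cancel_right, ih]
    ring

theorem sumSq_succ {p : ℕ} (θ : Fin p → ℝ) (e : ℕ → ℝ) (n : ℕ) :
    sumSq θ e (n + 1) = sumSq θ e n + ar θ e n ^ 2 := by
  rw [sumSq, Finset.sum_Icc_succ_top (by omega), sumSq]
  push_cast
  rw [add_sub_cancel_right]

theorem sumSq_nonneg {p : ℕ} (θ : Fin p → ℝ) (e : ℕ → ℝ) (n : ℕ) : 0 ≤ sumSq θ e n :=
  Finset.sum_nonneg fun _ _ => sq_nonneg _

theorem sumSq_mono {p : ℕ} (θ : Fin p → ℝ) (e : ℕ → ℝ) : Monotone (sumSq θ e) :=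
  monotone_nat_of_le_succ fun n => by rw [sumSq_succ]; linarith [sq_nonneg (ar θ e n)]

theorem sum_lag_sq_le {p : ℕ} (θ : Fin p → ℝ) (e : ℕ → ℝ) (n : ℕ) {a : ℕ} (ha : 1 ≤ a) :
    ∑ k ∈ Finset.Icc 1 n, ar θ e ((k : ℤ) - a) ^ 2 ≤ sumSq θ e n := by
  induction a, ha using Nat.le_induction with
  | base => rw [sumSq]; push_cast; rfl
  | succ a ha ih =>
    refine le_trans ?_ ih
    have h := sum_Icc_shift (fun k => ar θ e (k - a) ^ 2) n
    rw [ar_nonpos θ e (by omega : (0 : ℤ) - a ≤ 0)] at h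
    have h2 : ∀ k : ℕ, (k : ℤ) - ((a + 1 : ℕ) : ℤ) = (k : ℤ) - 1 - a := fun k => by
      push_cast; ring
    simp only [h2]
    linarith [sq_nonneg (ar θ e ((n : ℤ) - a))]

/-- The times are distinct and at most `t`; nonpositive ones contribute zero, so `J` may exceed `t`.
-/
theorem sum_backward_sq_le {p : ℕ} (θ : Fin p → ℝ) (e : ℕ → ℝ) (J t : ℕ) :
    ∑ j ∈ Finset.range J, ar θ e ((t : ℤ) - j) ^ 2 ≤ sumSq θ e (t + 1) := by
  induction t generalizing J with
  | zero =>
    rw [Finset.sum_eq_zero fun j _ => by rw [ar_nonpos θ e (by omega)]; ring]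
    exact sumSq_nonneg θ e _
  | succ t ih =>
    cases J with
    | zero => simpa using sumSq_nonneg θ e _
    | succ J =>
      rw [Finset.sum_range_succ', sumSq_succ]
      have h2 : ∀ j : ℕ, ((t + 1 : ℕ) : ℤ) - ((j + 1 : ℕ) : ℤ) = (t : ℤ) - j := fun j => by
        push_cast; ring
      simp only [h2, Nat.cast_zero, sub_zero]
      linarith [ih J]

theorem abs_coord_le {q : ℕ} {v : Fin q → ℝ} {B : ℝ} (hB : 0 ≤ B) (hv : ∀ l, |v l| ≤ B) (r : ℕ) :
    |coord v r| ≤ B := by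
  unfold coord
  split_ifs
  · exact hv _
  · simpa using hB

/-- The recursion expresses `e k` through `p + 1` values of the process, so Cauchy–Schwarz applies.
Read backwards, this is the lower bound on the energy of the process. -/
theorem noise_energy_le {p : ℕ} {θ : Fin p → ℝ} {B : ℝ} (hB : 0 ≤ B) (hθ : ∀ l, |θ l| ≤ B)
    (e : ℕ → ℝ) (n : ℕ) :
    ∑ k ∈ Finset.Icc 1 n, e k ^ 2 ≤ (2 + 2 * (p * B ^ 2) * p) * sumSq θ e (n + 1) := by
  have hk : ∀ k ∈ Finset.Icc 1 n, e k ^ 2 ≤ 2 * ar θ e k ^ 2 +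
      2 * (p * B ^ 2) * ∑ l ∈ Finset.Icc 1 p, ar θ e ((k : ℤ) - l) ^ 2 := by
    intro k hk
    rw [Finset.mem_Icc] at hk
    have hr := ar_rec θ e hk.1
    set A := ∑ l ∈ Finset.Icc 1 p, coord θ l * ar θ e ((k : ℤ) - l)
    have hA : A ^ 2 ≤ (p * B ^ 2) * ∑ l ∈ Finset.Icc 1 p, ar θ e ((k : ℤ) - l) ^ 2 := by
      refine (Finset.sum_mul_sq_le_sq_mul_sq _ _ _).trans ?_
      gcongr
      calc ∑ l ∈ Finset.Icc 1 p, coord θ l ^ 2 ≤ ∑ l ∈ Finset.Icc 1 p, B ^ 2 :=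
            Finset.sum_le_sum fun l _ => by
              rw [← sq_abs]
              exact pow_le_pow_left₀ (abs_nonneg _) (abs_coord_le hB hθ l) 2
        _ = p * B ^ 2 := by simp
    have : e k = ar θ e k - A := by rw [hr]; ring
    rw [this]
    nlinarith [sq_nonneg (ar θ e k + A)]
  have hx : ∑ k ∈ Finset.Icc 1 n, ar θ e k ^ 2 ≤ sumSq θ e (n + 1) := by
    have h := sum_Icc_shift (fun k => ar θ e k ^ 2) n
    rw [sumSq_succ, sumSq, h]
    linarith [sq_nonneg (ar θ e 0)]
  have hl : ∑ k ∈ Finset.Icc 1 n, ∑ l ∈ Finset.Icc 1 p, ar θ e ((k : ℤ) - l) ^ 2 ≤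
      p * sumSq θ e (n + 1) := by
    rw [Finset.sum_comm]
    calc _ ≤ ∑ l ∈ Finset.Icc 1 p, sumSq θ e (n + 1) := by
          refine Finset.sum_le_sum fun l hl => ?_
          exact (sum_lag_sq_le θ e n (Finset.mem_Icc.1 hl).1).trans (sumSq_mono θ e n.le_succ)
      _ = _ := by simp
  calc _ ≤ _ := Finset.sum_le_sum hk
    _ = 2 * ∑ k ∈ Finset.Icc 1 n, ar θ e k ^ 2 + 2 * (p * B ^ 2) *
        ∑ k ∈ Finset.Icc 1 n, ∑ l ∈ Finset.Icc 1 p, ar θ e ((k : ℤ) - l) ^ 2 := by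
      rw [Finset.sum_add_distrib, Finset.mul_sum, Finset.mul_sum]
    _ ≤ 2 * sumSq θ e (n + 1) + 2 * (p * B ^ 2) * (p * sumSq θ e (n + 1)) := by gcongr
    _ = _ := by ring

/-- Averaging the stability estimate over `J` starting times. -/
theorem mul_ar_sq_le {p : ℕ} {θ : Fin p → ℝ} {C : ℝ} (hC : 0 < C)
    (hstab : ∀ (e : ℕ → ℝ) (s : ℕ) (b : ℝ), 0 ≤ b → 1 ≤ s + p →
      (∀ i < p, |ar θ e (s + i : ℕ)| ≤ b) → ∀ n : ℕ,
      |ar θ e (s + n : ℕ)| ≤ C * (b + ∑ i ∈ Finset.range (n + 1), |e (s + i + p)|))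
    (hp : 1 ≤ p) (e : ℕ → ℝ) {n J : ℕ} (hn : J + p ≤ n) :
    J * ar θ e n ^ 2 ≤ 2 * C ^ 2 * (p * sumSq θ e n +
      J * ((p + J) * ∑ r ∈ Finset.Ioc (n - J) (n + p), e r ^ 2)) := by
  set W := ∑ r ∈ Finset.Ioc (n - J) (n + p), e r ^ 2
  have hj : ∀ j ∈ Finset.range J, ar θ e n ^ 2 ≤ 2 * C ^ 2 *
      (∑ i ∈ Finset.range p, ar θ e ((n - p + i : ℕ) - (j : ℤ)) ^ 2 + (p + J) * W) := by
    intro j hj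
    rw [Finset.mem_range] at hj
    -- The recursion is restarted from the block of times `n-p-j, …, n-1-j`. The stability estimate
    -- then uses noise up to time `n + p`, whence the upper end of the window in `W`.
    set s := n - p - j with hs
    set b2 := ∑ i ∈ Finset.range p, ar θ e ((n - p + i : ℕ) - (j : ℤ)) ^ 2
    have hb2 : 0 ≤ b2 := Finset.sum_nonneg fun _ _ => sq_nonneg _
    have h := hstab e s (Real.sqrt b2) (Real.sqrt_nonneg _) (by omega) (by
      intro i hi
      apply Real.abs_le_sqrt
      have hsi : ((s + i : ℕ) : ℤ) = ((n - p + i : ℕ) : ℤ) - (j : ℤ) := by omega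
      rw [hsi]
      exact Finset.single_le_sum (f := fun i : ℕ => ar θ e ((n - p + i : ℕ) - (j : ℤ)) ^ 2)
        (fun _ _ => sq_nonneg _) (Finset.mem_range.2 hi)) (p + j)
    rw [show s + (p + j) = n by omega] at h
    set E := ∑ i ∈ Finset.range (p + j + 1), |e (s + i + p)|
    have hE0 : 0 ≤ E := Finset.sum_nonneg fun _ _ => abs_nonneg _
    have hE : E ^ 2 ≤ (p + J) * W := by
      calc E ^ 2 ≤ (Finset.range (p + j + 1)).card *
            ∑ i ∈ Finset.range (p + j + 1), |e (s + i + p)| ^ 2 := sq_sum_le_card_mul_sum_sq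
        _ ≤ (p + J) * W := by
          rw [Finset.card_range]
          gcongr
          · exact_mod_cast (by omega : p + j + 1 ≤ p + J)
          simp only [sq_abs]
          rw [← Finset.sum_image (f := fun r => e r ^ 2) (g := fun i => s + i + p)
            (by intro a _ b _ h; simp only at h; omega)]
          refine Finset.sum_le_sum_of_subset_of_nonneg ?_ fun _ _ _ => sq_nonneg _
          intro r hr
          obtain ⟨i, hi, rfl⟩ := Finset.mem_image.1 hr
          rw [Finset.mem_range] at hi
          rw [Finset.mem_Ioc]
          omega
    have h1 : ar θ e n ^ 2 ≤ (C * (Real.sqrt b2 + E)) ^ 2 := by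
      rw [← sq_abs]
      exact pow_le_pow_left₀ (abs_nonneg _) h 2
    have h2 : (Real.sqrt b2 + E) ^ 2 ≤ 2 * (b2 + (p + J) * W) := by
      have := Real.sq_sqrt hb2
      nlinarith [sq_nonneg (Real.sqrt b2 - E)]
    rw [mul_pow] at h1
    nlinarith [sq_nonneg C]
  have hsum : ∑ j ∈ Finset.range J, ∑ i ∈ Finset.range p,
      ar θ e ((n - p + i : ℕ) - (j : ℤ)) ^ 2 ≤ p * sumSq θ e n := by
    -- For a fixed position `i` in the block, varying `j` visits distinct times, so each of the `p`
    -- positions costs at most one `sumSq`.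
    rw [Finset.sum_comm]
    calc _ ≤ ∑ i ∈ Finset.range p, sumSq θ e n := by
          refine Finset.sum_le_sum fun i hi => ?_
          rw [Finset.mem_range] at hi
          exact (sum_backward_sq_le θ e J _).trans (sumSq_mono θ e (by omega))
      _ = _ := by simp
  calc J * ar θ e n ^ 2 = ∑ j ∈ Finset.range J, ar θ e n ^ 2 := by simp
    _ ≤ _ := Finset.sum_le_sum hj
    _ = 2 * C ^ 2 * (∑ j ∈ Finset.range J, ∑ i ∈ Finset.range p,
          ar θ e ((n - p + i : ℕ) - (j : ℤ)) ^ 2 + J * ((p + J) * W)) := by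
      rw [← Finset.mul_sum, Finset.sum_add_distrib]
      simp
    _ ≤ _ := by gcongr

/-- If the empirical second moments of the noise stay close to `v`, then `∑ x_{k-1}²` grows at
least linearly and dominates `x_n²`, uniformly over a compact set of parameters. -/
theorem exists_sumSq_bounds {p : ℕ} (hp : 1 ≤ p) {K : Set (Fin p → ℝ)} (hK : IsCompact K)
    (h1 : ∀ θ ∈ K, Condition1 θ) (h2 : ∀ θ ∈ K, Condition2 θ) {v : ℝ} (hv : 0 < v) :
    ∃ c : ℝ, 0 < c ∧ ∀ δ : ℝ, 0 < δ → ∃ τ : ℝ, 0 < τ ∧ ∃ N : ℕ, ∀ (e : ℕ → ℝ) (m : ℕ),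
      (∀ n, m ≤ n → |∑ k ∈ Finset.Icc 1 n, e k ^ 2 - v * n| ≤ τ * n) →
      ∀ θ ∈ K, ∀ n, m + N ≤ n → c * n ≤ sumSq θ e n ∧ ar θ e n ^ 2 ≤ δ * sumSq θ e n := by
  obtain ⟨C, hC, hstab⟩ := exists_abs_ar_le hK h1 h2
  obtain ⟨B, hB0, hB⟩ : ∃ B : ℝ, 0 ≤ B ∧ ∀ θ ∈ K, ∀ l, |θ l| ≤ B := by
    obtain ⟨B, hB⟩ := hK.isBounded.exists_norm_le
    refine ⟨max B 0, le_max_right _ _, fun θ hθ l => ?_⟩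
    exact (norm_le_pi_norm θ l).trans ((hB θ hθ).trans (le_max_left _ _))
  set A : ℝ := 2 + 2 * (p * B ^ 2) * p with hA
  have hA0 : 0 < A := by positivity
  refine ⟨v / (4 * A), by positivity, fun δ hδ => ?_⟩
  set c := v / (4 * A) with hc
  have hc0 : 0 < c := by positivity
  -- `J` makes the block term at most half of `δ * sumSq`. With `J` fixed, `N` and `τ` give a
  -- quarter each to the mean and to the fluctuation of the noise energy in the window.
  obtain ⟨J, hJ⟩ := exists_nat_ge (max 1 (4 * C ^ 2 * p / δ))
  have hJ1 : (1 : ℝ) ≤ J := (le_max_left _ _).trans hJ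
  have hJ2 : 4 * C ^ 2 * p ≤ J * δ := by
    have := (le_max_right _ _).trans hJ
    rwa [div_le_iff₀ hδ] at this
  set G : ℝ := 2 * C ^ 2 * (p + J) with hG
  have hG0 : 0 < G := by positivity
  obtain ⟨N, hN⟩ := exists_nat_ge (G * (v * (p + J)) / (δ * c / 4))
  refine ⟨min (v / 2) (δ * c / (12 * G)), by positivity, N + J + p + 2, ?_⟩
  set τ := min (v / 2) (δ * c / (12 * G)) with hτ
  have hτ0 : 0 < τ := by positivity
  have hτ1 : τ ≤ v / 2 := min_le_left _ _
  have hτ2 : 12 * G * τ ≤ δ * c := by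
    have : τ ≤ δ * c / (12 * G) := min_le_right _ _
    rw [le_div_iff₀ (by positivity)] at this
    linarith
  intro e m hq θ hθ n hn
  set q : ℕ → ℝ := fun n => ∑ k ∈ Finset.Icc 1 n, e k ^ 2 with hqd
  have hn2 : (2 : ℝ) ≤ n := by exact_mod_cast (by omega : 2 ≤ n)
  have hcS : c * n ≤ sumSq θ e n := by
    have h3 := noise_energy_le hB0 (hB θ hθ) e (n - 1)
    rw [Nat.sub_add_cancel (by omega)] at h3
    have h4 := neg_le_of_abs_le (hq (n - 1) (by omega))
    rw [Nat.cast_sub (by omega), Nat.cast_one] at h4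
    have h5 : v / 4 * n ≤ A * sumSq θ e n := by nlinarith
    have h6 : c * n = v / 4 * n / A := by rw [hc]; field_simp
    rw [h6, div_le_iff₀ hA0]
    linarith
  refine ⟨hcS, ?_⟩
  have h3 := mul_ar_sq_le hC (hstab θ hθ) hp e (n := n) (J := J) (by omega)
  set W := ∑ r ∈ Finset.Ioc (n - J) (n + p), e r ^ 2 with hW
  have hWq : W = q (n + p) - q (n - J) := by
    rw [hW, hqd]
    simp only
    rw [eq_sub_iff_add_eq', ← Finset.sum_union]
    · congr 1
      ext r
      simp only [Finset.mem_union, Finset.mem_Icc, Finset.mem_Ioc]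
      omega
    · rw [Finset.disjoint_left]
      intro r
      simp only [Finset.mem_Icc, Finset.mem_Ioc]
      omega
  have hW1 : W ≤ v * (p + J) + τ * (3 * n) := by
    have h4 := le_of_abs_le (hq (n + p) (by omega))
    have h5 := neg_le_of_abs_le (hq (n - J) (by omega))
    rw [Nat.cast_sub (by omega)] at h5
    push_cast at h4
    have h6 : (p : ℝ) ≤ n := by exact_mod_cast (by omega : p ≤ n)
    rw [hWq]
    nlinarith
  have hNn : G * (v * (p + J)) ≤ δ * c / 4 * n := by
    rw [div_le_iff₀ (by positivity)] at hN
    have : (N : ℝ) ≤ n := by exact_mod_cast (by omega : N ≤ n)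
    nlinarith [mul_pos hδ hc0]
  have hGW : G * W ≤ δ / 2 * sumSq θ e n := by
    calc G * W ≤ G * (v * (p + J) + τ * (3 * n)) := by gcongr
      _ = G * (v * (p + J)) + 12 * G * τ * (n / 4) := by ring
      _ ≤ δ * c / 4 * n + δ * c * (n / 4) := by gcongr
      _ = δ / 2 * (c * n) := by ring
      _ ≤ _ := by gcongr
  have hS := sumSq_nonneg θ e n
  have h7 : J * ar θ e n ^ 2 ≤ J * (δ * sumSq θ e n) := by
    calc J * ar θ e n ^ 2 ≤ _ := h3
      _ = 4 * C ^ 2 * p * (sumSq θ e n / 2) + J * (G * W) := by rw [hG]; ring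
      _ ≤ J * δ * (sumSq θ e n / 2) + J * (δ / 2 * sumSq θ e n) := by gcongr
      _ = _ := by ring
  exact le_of_mul_le_mul_left h7 (by linarith)

/-! ### Uniform conditioning of the linear system -/

/-- The left-hand side of the `j`-th equation of the linear system. -/
noncomputable def systemLhs {p : ℕ} (θ : Fin p → ℝ) (Y : Fin (p - 1) → ℝ) (j : ℕ) : ℝ :=
  -(∑ k ∈ Finset.Icc 1 (j - 1), coord θ (j - k) * coord Y k) + coord Y j
    - (∑ k ∈ Finset.Icc 1 (p - j), coord θ (k + j) * coord Y k)

theorem coord_add {q : ℕ} (v w : Fin q → ℝ) (r : ℕ) : coord (v + w) r = coord v r + coord w r := by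
  unfold coord
  split_ifs <;> simp

theorem coord_smul {q : ℕ} (a : ℝ) (v : Fin q → ℝ) (r : ℕ) :
    coord (a • v) r = a * coord v r := by
  unfold coord
  split_ifs <;> simp

theorem systemLhs_add {p : ℕ} (θ : Fin p → ℝ) (Y Y' : Fin (p - 1) → ℝ) (j : ℕ) :
    systemLhs θ (Y + Y') j = systemLhs θ Y j + systemLhs θ Y' j := by
  simp only [systemLhs, coord_add, mul_add, Finset.sum_add_distrib]
  ring

theorem systemLhs_smul {p : ℕ} (θ : Fin p → ℝ) (a : ℝ) (Y : Fin (p - 1) → ℝ) (j : ℕ) :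
    systemLhs θ (a • Y) j = a * systemLhs θ Y j := by
  simp only [systemLhs, coord_smul, mul_left_comm _ a, ← Finset.mul_sum]
  ring

theorem continuous_systemLhs {p : ℕ} (j : ℕ) :
    Continuous fun y : (Fin p → ℝ) × (Fin (p - 1) → ℝ) => systemLhs y.1 y.2 j := by
  have h1 : ∀ r, Continuous fun y : (Fin p → ℝ) × (Fin (p - 1) → ℝ) => coord y.1 r :=
    fun r => (continuous_coord r).comp continuous_fst
  have h2 : ∀ r, Continuous fun y : (Fin p → ℝ) × (Fin (p - 1) → ℝ) => coord y.2 r :=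
    fun r => (continuous_coord r).comp continuous_snd
  unfold systemLhs
  exact ((continuous_finsetSum _ fun k _ => (h1 _).mul (h2 _)).neg.add (h2 _)).sub
    (continuous_finsetSum _ fun k _ => (h1 _).mul (h2 _))

theorem isSolution_kappa {p : ℕ} {θ : Fin p → ℝ} (h : ∃! Y, IsSolution θ Y) :
    IsSolution θ (kappa θ) :=
  Classical.epsilon_spec h.exists

/-- Approximate solutions of the linear system are close to the solution, uniformly over a compact
set of parameters for which the system is uniquely solvable. -/
theorem exists_abs_sub_kappa_le {p : ℕ} {K : Set (Fin p → ℝ)} (hK : IsCompact K)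
    (h : ∀ θ ∈ K, ∃! Y, IsSolution θ Y) :
    ∃ c : ℝ, 0 < c ∧ ∀ θ ∈ K, ∀ (Y : Fin (p - 1) → ℝ) (t : ℝ),
      (∀ j ∈ Finset.Icc 1 (p - 1), |systemLhs θ Y j - coord θ j| ≤ t) →
      ∀ i, |Y i - kappa θ i| ≤ c * t := by
  set f : (Fin p → ℝ) × (Fin (p - 1) → ℝ) → ℝ :=
    fun y => ∑ j ∈ Finset.Icc 1 (p - 1), |systemLhs y.1 y.2 j| with hf
  have hfc : Continuous f := continuous_finsetSum _ fun j _ => (continuous_systemLhs j).abs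
  obtain ⟨a, ha, hmin⟩ : ∃ a : ℝ, 0 < a ∧
      ∀ y ∈ K ×ˢ Metric.sphere (0 : Fin (p - 1) → ℝ) 1, a ≤ f y := by
    rcases (K ×ˢ Metric.sphere (0 : Fin (p - 1) → ℝ) 1).eq_empty_or_nonempty with he | hne
    · exact ⟨1, one_pos, fun y hy => by rw [he] at hy; exact hy.elim⟩
    obtain ⟨y, hy, hmin⟩ := (hK.prod (isCompact_sphere 0 1)).exists_isMinOn hne hfc.continuousOn
    refine ⟨f y, ?_, fun y' hy' => hmin hy'⟩
    have hf0 : 0 ≤ f y := Finset.sum_nonneg fun _ _ => abs_nonneg _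
    -- A zero of `f` on the unit sphere would be a nontrivial homogeneous solution; adding it to the
    -- solution would break uniqueness.
    refine lt_of_le_of_ne hf0 fun h0 => ?_
    have hz : ∀ j ∈ Finset.Icc 1 (p - 1), systemLhs y.1 y.2 j = 0 := fun j hj =>
      abs_eq_zero.1 ((Finset.sum_eq_zero_iff_of_nonneg fun _ _ => abs_nonneg _).1 h0.symm j hj)
    obtain ⟨Y, hY, huniq⟩ := h y.1 hy.1
    have h2 : IsSolution y.1 (Y + y.2) := by
      intro j hj
      have h3 : systemLhs y.1 (Y + y.2) j = coord y.1 j := by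
        rw [systemLhs_add, hz j hj, add_zero]
        exact hY j hj
      exact h3
    have h4 : y.2 = 0 := by simpa using huniq _ h2
    have h5 := hy.2
    rw [h4] at h5
    simp at h5
  refine ⟨p / a + 1, by positivity, fun θ hθ Y t ht i => ?_⟩
  have hp : 1 ≤ p - 1 := by have := i.isLt; omega
  have ht0 : 0 ≤ t := (abs_nonneg _).trans (ht 1 (Finset.mem_Icc.2 ⟨le_refl _, hp⟩))
  set w := Y - kappa θ with hw
  have hlow : a * ‖w‖ ≤ f (θ, w) := by
    rcases eq_or_ne w 0 with h0 | h0
    · rw [h0, norm_zero, mul_zero]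
      exact Finset.sum_nonneg fun _ _ => abs_nonneg _
    · have hn : 0 < ‖w‖ := norm_pos_iff.2 h0
      have h1 := hmin (θ, ‖w‖⁻¹ • w) ⟨hθ, by
        rw [mem_sphere_zero_iff_norm, norm_smul, norm_inv, norm_norm, inv_mul_cancel₀ hn.ne']⟩
      simp only [hf, systemLhs_smul, abs_mul, abs_inv, abs_norm, ← Finset.mul_sum] at h1
      rw [inv_mul_eq_div, le_div_iff₀ hn] at h1
      exact h1
  have hup : f (θ, w) ≤ p * t := by
    have h1 : ∀ j ∈ Finset.Icc 1 (p - 1), |systemLhs θ w j| ≤ t := by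
      intro j hj
      have h2 : systemLhs θ Y j = systemLhs θ w j + systemLhs θ (kappa θ) j := by
        rw [← systemLhs_add, hw, sub_add_cancel]
      have h3 : systemLhs θ (kappa θ) j = coord θ j := isSolution_kappa (h θ hθ) j hj
      have h4 := ht j hj
      rwa [h2, h3, add_sub_cancel_right] at h4
    calc f (θ, w) ≤ ∑ j ∈ Finset.Icc 1 (p - 1), t := Finset.sum_le_sum h1
      _ = ((p - 1 : ℕ) : ℝ) * t := by simp
      _ ≤ p * t := by gcongr; omega
  have hwi : |Y i - kappa θ i| ≤ ‖w‖ := norm_le_pi_norm w i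
  have h6 : ‖w‖ ≤ p / a * t := by
    rw [div_mul_eq_mul_div, le_div_iff₀ ha]
    linarith
  linarith

/-! ### Lagged products and the approximate linear system -/

/-- `∑_{k=1}^n x_{k-a} x_{k-b}`. -/
noncomputable def crossSum {p : ℕ} (θ : Fin p → ℝ) (e : ℕ → ℝ) (n a b : ℕ) : ℝ :=
  ∑ k ∈ Finset.Icc 1 n, ar θ e ((k : ℤ) - a) * ar θ e ((k : ℤ) - b)

theorem crossSum_comm {p : ℕ} (θ : Fin p → ℝ) (e : ℕ → ℝ) (n a b : ℕ) :
    crossSum θ e n a b = crossSum θ e n b a :=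
  Finset.sum_congr rfl fun _ _ => mul_comm _ _

theorem crossSum_succ_add {p : ℕ} (θ : Fin p → ℝ) (e : ℕ → ℝ) (n a b : ℕ) :
    crossSum θ e n (a + 1) (b + 1) + ar θ e ((n : ℤ) - a) * ar θ e ((n : ℤ) - b) =
      crossSum θ e n a b := by
  have h := sum_Icc_shift (fun k => ar θ e (k - a) * ar θ e (k - b)) n
  rw [ar_nonpos θ e (by omega : (0 : ℤ) - a ≤ 0), zero_mul, add_zero] at h
  rw [crossSum, crossSum, ← h]
  congr 1
  refine Finset.sum_congr rfl fun k _ => ?_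
  congr 2 <;> push_cast <;> ring

theorem crossSum_one_one {p : ℕ} (θ : Fin p → ℝ) (e : ℕ → ℝ) (n : ℕ) :
    crossSum θ e n 1 1 = sumSq θ e n := by
  rw [crossSum, sumSq]
  refine Finset.sum_congr rfl fun k _ => ?_
  push_cast
  ring

theorem fisher_apply {p : ℕ} (θ : Fin p → ℝ) (e : ℕ → ℝ) (n : ℕ) (i j : Fin p) :
    fisher θ e n i j = crossSum θ e n (i + 1) (j + 1) := by
  rw [fisher, Matrix.sum_apply, crossSum]
  refine Finset.sum_congr rfl fun k _ => ?_
  rw [Matrix.vecMulVec_apply, stateVec, stateVec]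
  congr 2 <;> push_cast <;> ring

/-- Each unit shift of both lags drops one product of two recent values, at most `r` by the
arithmetic–geometric mean inequality. -/
theorem abs_crossSum_sub_le {p : ℕ} {θ : Fin p → ℝ} {e : ℕ → ℝ} {n : ℕ} {r : ℝ}
    (hr : ∀ i ≤ p, ar θ e ((n : ℤ) - i) ^ 2 ≤ r) {a h : ℕ} (hah : a + h ≤ p) :
    |crossSum θ e n a (a + h) - crossSum θ e n 0 h| ≤ a * r := by
  induction a with
  | zero => simp
  | succ a ih =>
    have h1 := crossSum_succ_add θ e n a (a + h)
    have h2 := hr a (by omega)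
    have h3 := hr (a + h) (by omega)
    have h4 := abs_le.1 (ih (by omega))
    rw [add_right_comm]
    push_cast at *
    rw [abs_le]
    constructor
    · nlinarith [sq_nonneg (ar θ e ((n : ℤ) - a) - ar θ e ((n : ℤ) - (a + h)))]
    · nlinarith [sq_nonneg (ar θ e ((n : ℤ) - a) + ar θ e ((n : ℤ) - (a + h)))]

/-- Both sums are compared with lags `0` and `Nat.dist a b`: at most `p` shifts for the first and
one for the second. This is the approximate Toeplitz property. -/
theorem abs_crossSum_sub_dist_le {p : ℕ} {θ : Fin p → ℝ} {e : ℕ → ℝ} {n : ℕ} {r : ℝ} (hr0 : 0 ≤ r)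
    (hr : ∀ i ≤ p, ar θ e ((n : ℤ) - i) ^ 2 ≤ r) {a b : ℕ} (ha : a ≤ p) (hb : b ≤ p)
    (hd : Nat.dist a b + 1 ≤ p) :
    |crossSum θ e n a b - crossSum θ e n 1 (1 + Nat.dist a b)| ≤ (p + 1) * r := by
  wlog hab : a ≤ b generalizing a b
  · rw [crossSum_comm, Nat.dist_comm]
    exact this hb ha (by rwa [Nat.dist_comm]) (by omega)
  obtain ⟨h, rfl⟩ := Nat.exists_eq_add_of_le hab
  have hdist : Nat.dist a (a + h) = h := by rw [Nat.dist_eq_sub_of_le hab]; omega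
  rw [hdist] at hd ⊢
  have h1 := abs_le.1 (abs_crossSum_sub_le hr hb)
  have h2 := abs_le.1 (abs_crossSum_sub_le hr (a := 1) (h := h) (by omega))
  have h3 : (a : ℝ) * r ≤ p * r := by gcongr
  push_cast at h2
  rw [abs_le]
  constructor <;> linarith

/-- The cases `l < j`, `l = j`, `l > j` produce the two sums and the right-hand side of the linear
system. -/
theorem sum_Icc_dist {p j : ℕ} (hj : 1 ≤ j) (hjp : j ≤ p) (u r : ℕ → ℝ) (hr : r 0 = 1) :
    ∑ l ∈ Finset.Icc 1 p, u l * r (Nat.dist l j) =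
      ∑ k ∈ Finset.Icc 1 (j - 1), u (j - k) * r k + u j +
        ∑ k ∈ Finset.Icc 1 (p - j), u (k + j) * r k := by
  have hsplit : Finset.Icc 1 p = (Finset.Icc 1 (j - 1) ∪ {j}) ∪ Finset.Icc (j + 1) p := by
    ext l
    simp only [Finset.mem_union, Finset.mem_Icc, Finset.mem_singleton]
    omega
  rw [hsplit, Finset.sum_union, Finset.sum_union, Finset.sum_singleton, Nat.dist_self, hr, mul_one]
  · refine congrArg₂ (· + ·) (congrArg (· + u j) ?_) ?_
    · refine Finset.sum_nbij' (fun l => j - l) (fun l => j - l) ?_ ?_ ?_ ?_ ?_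
      · intro l hl; rw [Finset.mem_Icc] at *; omega
      · intro l hl; rw [Finset.mem_Icc] at *; omega
      · intro l hl; rw [Finset.mem_Icc] at *; omega
      · intro l hl; rw [Finset.mem_Icc] at *; omega
      · intro l hl
        rw [Finset.mem_Icc] at hl
        rw [Nat.dist_eq_sub_of_le (by omega), Nat.sub_sub_self (by omega)]
    · refine Finset.sum_nbij' (fun l => l - j) (fun l => l + j) ?_ ?_ ?_ ?_ ?_
      · intro l hl; rw [Finset.mem_Icc] at *; omega
      · intro l hl; rw [Finset.mem_Icc] at *; omega
      · intro l hl; rw [Finset.mem_Icc] at *; omega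
      · intro l hl; rw [Finset.mem_Icc] at *; omega
      · intro l hl
        rw [Finset.mem_Icc] at hl
        rw [Nat.dist_eq_sub_of_le_right (by omega), Nat.sub_add_cancel (by omega)]
  · rw [Finset.disjoint_left]
    intro l
    simp only [Finset.mem_Icc, Finset.mem_singleton]
    omega
  · rw [Finset.disjoint_left]
    intro l
    simp only [Finset.mem_union, Finset.mem_Icc, Finset.mem_singleton]
    omega

/-- An empirical Yule–Walker equation: the recursion for `x_k` multiplied by `x_{k-j}` and summed
over `k`. -/
theorem crossSum_zero_left {p : ℕ} (θ : Fin p → ℝ) (e : ℕ → ℝ) (n j : ℕ) :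
    crossSum θ e n 0 j = ∑ l ∈ Finset.Icc 1 p, coord θ l * crossSum θ e n l j +
      ∑ k ∈ Finset.Icc 1 n, ar θ e ((k : ℤ) - j) * e k := by
  simp only [crossSum, Finset.mul_sum]
  rw [Finset.sum_comm, ← Finset.sum_add_distrib]
  refine Finset.sum_congr rfl fun k hk => ?_
  rw [Nat.cast_zero, sub_zero, ar_rec θ e (Finset.mem_Icc.1 hk).1, add_mul, Finset.sum_mul]
  congr 1
  · exact Finset.sum_congr rfl fun l _ => by ring
  · ring

theorem frobenius_norm_le {p : ℕ} {A : Matrix (Fin p) (Fin p) ℝ} {r : ℝ} (hr : 0 ≤ r)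
    (h : ∀ i j, |A i j| ≤ r) : ‖A‖ ≤ p * r := by
  rw [Matrix.frobenius_norm_def, ← Real.sqrt_eq_rpow]
  apply Real.sqrt_le_iff.2
  refine ⟨by positivity, ?_⟩
  calc ∑ i, ∑ j, ‖A i j‖ ^ (2 : ℝ) ≤ ∑ _i : Fin p, ∑ _j : Fin p, r ^ 2 := by
        refine Finset.sum_le_sum fun i _ => Finset.sum_le_sum fun j _ => ?_
        rw [Real.rpow_two]
        exact pow_le_pow_left₀ (norm_nonneg _) (h i j) 2
    _ = (p * r) ^ 2 := by simp; ring

/-- The normalized Fisher matrix is close to `L(θ)`, uniformly over a compact set of parameters,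
once the last values of the process and the correlations with the noise are small compared with
`∑ x_{k-1}²`. -/
theorem exists_norm_sub_limitMatrix_lt {p : ℕ} {K : Set (Fin p → ℝ)}
    (hK : IsCompact K) (h : ∀ θ ∈ K, ∃! Y, IsSolution θ Y) {δ : ℝ} (hδ : 0 < δ) :
    ∃ t : ℝ, 0 < t ∧ ∀ θ ∈ K, ∀ (e : ℕ → ℝ) (n : ℕ), 0 < sumSq θ e n →
      (∀ i ≤ p, ar θ e ((n : ℤ) - i) ^ 2 ≤ t * sumSq θ e n) →
      (∀ j ∈ Finset.Icc 1 (p - 1),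
        |∑ k ∈ Finset.Icc 1 n, ar θ e ((k : ℤ) - j) * e k| ≤ t * sumSq θ e n) →
      ‖(sumSq θ e n)⁻¹ • fisher θ e n - limitMatrix θ‖ < δ := by
  obtain ⟨c, hc, hκ⟩ := exists_abs_sub_kappa_le hK h
  obtain ⟨B, hB0, hB⟩ : ∃ B : ℝ, 0 ≤ B ∧ ∀ θ ∈ K, ∀ l, |θ l| ≤ B := by
    obtain ⟨B, hB⟩ := hK.isBounded.exists_norm_le
    refine ⟨max B 0, le_max_right _ _, fun θ hθ l => ?_⟩
    exact (norm_le_pi_norm θ l).trans ((hB θ hθ).trans (le_max_left _ _))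
  set G : ℝ := (p + 1) + c * ((p + 1) + p * (B * (p + 1)) + 1) with hG
  have hG0 : 0 < G := by positivity
  refine ⟨δ / (2 * (p + 1) * G), by positivity, ?_⟩
  set t := δ / (2 * (p + 1) * G) with ht
  have ht0 : 0 < t := by positivity
  intro θ hθ e n hS hx hT
  set S := sumSq θ e n with hSd
  set r : ℕ → ℝ := fun h => crossSum θ e n 1 (1 + h) / S with hr
  have hr0 : r 0 = 1 := by
    simp only [hr, add_zero, crossSum_one_one]
    exact div_self hS.ne'
  have hD : ∀ a b, a ≤ p → b ≤ p → Nat.dist a b + 1 ≤ p →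
      |crossSum θ e n a b / S - r (Nat.dist a b)| ≤ (p + 1) * t := by
    intro a b ha hb hd
    have := abs_crossSum_sub_dist_le (by positivity) hx ha hb hd
    simp only [hr]
    rw [← sub_div, abs_div, abs_of_pos hS, div_le_iff₀ hS]
    linarith
  set Y : Fin (p - 1) → ℝ := fun i => r (i + 1) with hY
  have hYc : ∀ k, 1 ≤ k → k ≤ p - 1 → coord Y k = r k := by
    intro k hk hk'
    rw [coord, dif_pos ⟨hk, hk'⟩]
    simp only [hY]
    rw [Nat.sub_add_cancel hk]
  have hres : ∀ j ∈ Finset.Icc 1 (p - 1), |systemLhs θ Y j - coord θ j| ≤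
      ((p + 1) + p * (B * (p + 1)) + 1) * t := by
    intro j hj
    have hT' := hT j hj
    rw [Finset.mem_Icc] at hj
    have h1 : systemLhs θ Y j - coord θ j =
        r j - ∑ l ∈ Finset.Icc 1 p, coord θ l * r (Nat.dist l j) := by
      rw [sum_Icc_dist hj.1 (by omega) _ r hr0, systemLhs, hYc j hj.1 hj.2]
      have e1 : ∑ k ∈ Finset.Icc 1 (j - 1), coord θ (j - k) * coord Y k =
          ∑ k ∈ Finset.Icc 1 (j - 1), coord θ (j - k) * r k :=
        Finset.sum_congr rfl fun k hk => by
          rw [Finset.mem_Icc] at hk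
          rw [hYc k hk.1 (by omega)]
      have e2 : ∑ k ∈ Finset.Icc 1 (p - j), coord θ (k + j) * coord Y k =
          ∑ k ∈ Finset.Icc 1 (p - j), coord θ (k + j) * r k :=
        Finset.sum_congr rfl fun k hk => by
          rw [Finset.mem_Icc] at hk
          rw [hYc k hk.1 (by omega)]
      rw [e1, e2]
      ring
    have h2 := crossSum_zero_left θ e n j
    set T := ∑ k ∈ Finset.Icc 1 n, ar θ e ((k : ℤ) - j) * e k
    -- The residual consists of Toeplitz defects and the noise correlation only, as the exact lagged
    -- products satisfy `crossSum_zero_left`.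
    have h3 : systemLhs θ Y j - coord θ j = -(crossSum θ e n 0 j / S - r (Nat.dist 0 j)) +
        ∑ l ∈ Finset.Icc 1 p, coord θ l * (crossSum θ e n l j / S - r (Nat.dist l j)) +
        T / S := by
      rw [h1, h2, Nat.dist_zero_left]
      simp only [mul_sub, Finset.sum_sub_distrib, add_div, Finset.sum_div, mul_div_assoc]
      ring
    have h4 := hD 0 j (by omega) (by omega) (by rw [Nat.dist_zero_left]; omega)
    have h5 : |∑ l ∈ Finset.Icc 1 p, coord θ l * (crossSum θ e n l j / S - r (Nat.dist l j))| ≤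
        p * (B * ((p + 1) * t)) := by
      refine (Finset.abs_sum_le_sum_abs _ _).trans ?_
      calc _ ≤ ∑ l ∈ Finset.Icc 1 p, B * ((p + 1) * t) := by
            refine Finset.sum_le_sum fun l hl => ?_
            rw [Finset.mem_Icc] at hl
            rw [abs_mul]
            refine mul_le_mul (abs_coord_le hB0 (hB θ hθ) l) ?_ (abs_nonneg _) hB0
            exact hD l j hl.2 (by omega) (by unfold Nat.dist; omega)
        _ = _ := by simp
    have h6 : |T / S| ≤ t := by
      rwa [abs_div, abs_of_pos hS, div_le_iff₀ hS]
    rw [h3]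
    calc _ ≤ |-(crossSum θ e n 0 j / S - r (Nat.dist 0 j))| +
        |∑ l ∈ Finset.Icc 1 p, coord θ l * (crossSum θ e n l j / S - r (Nat.dist l j))| +
        |T / S| := abs_add_three _ _ _
      _ ≤ (p + 1) * t + p * (B * ((p + 1) * t)) + t := by
        rw [abs_neg]
        gcongr
      _ = _ := by ring
  have hκY := hκ θ hθ Y _ hres
  have hentry : ∀ i j : Fin p, |((sumSq θ e n)⁻¹ • fisher θ e n - limitMatrix θ) i j| ≤ G * t := by
    intro i j
    have hi := i.isLt
    have hj := j.isLt
    have hdist : Nat.dist ((i : ℕ) + 1) ((j : ℕ) + 1) = Nat.dist i j :=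
      Nat.dist_add_add_right _ _ _
    have h1 := hD (i + 1) (j + 1) (by omega) (by omega) (by rw [hdist]; unfold Nat.dist; omega)
    rw [hdist] at h1
    have h2 : ((sumSq θ e n)⁻¹ • fisher θ e n - limitMatrix θ) i j =
        (crossSum θ e n (i + 1) (j + 1) / S - r (Nat.dist i j)) +
          (r (Nat.dist i j) - limitMatrix θ i j) := by
      rw [Matrix.sub_apply, Matrix.smul_apply, fisher_apply, smul_eq_mul, ← hSd]
      ring
    have h3 : |r (Nat.dist i j) - limitMatrix θ i j| ≤
        c * (((p + 1) + p * (B * (p + 1)) + 1) * t) := by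
      rw [limitMatrix, Matrix.of_apply]
      split_ifs with hij
      · rw [hij, Nat.dist_self, hr0, sub_self, abs_zero]
        positivity
      · have hne : (i : ℕ) ≠ j := fun hh => hij (Fin.ext hh)
        have e1 : (((i : ℕ) : ℤ) - ((j : ℕ) : ℤ)).natAbs = Nat.dist i j := by
          unfold Nat.dist; omega
        have hd1 : 1 ≤ Nat.dist i j := by unfold Nat.dist; omega
        have hd2 : Nat.dist i j ≤ p - 1 := by unfold Nat.dist; omega
        rw [e1, ← hYc _ hd1 hd2, coord, coord, dif_pos ⟨hd1, hd2⟩, dif_pos ⟨hd1, hd2⟩]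
        exact hκY _
    rw [h2]
    calc _ ≤ _ := abs_add_le _ _
      _ ≤ _ := add_le_add h1 h3
      _ = G * t := by rw [hG]; ring
  refine (frobenius_norm_le (by positivity) hentry).trans_lt ?_
  have : p * (G * t) = δ * (p / (2 * (p + 1))) := by
    rw [ht]; field_simp
  rw [this]
  have h1 : (p : ℝ) / (2 * (p + 1)) < 1 := by
    rw [div_lt_one (by positivity)]
    have : (0 : ℝ) ≤ p := Nat.cast_nonneg p
    linarith
  nlinarith

/-! ### Martingale transforms of independent noise -/

section MartingaleTransform

variable {Ω : Type*} [mΩ : MeasurableSpace Ω] {μ : Measure Ω}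
  {ξ w : ℕ → Ω → ℝ} (hξ : ∀ i, Measurable (ξ i))

theorem indepFun_of_measurable_natural (hind : iIndepFun ξ μ) {n : ℕ} {g : Ω → ℝ}
    (hg : Measurable[Filtration.natural ξ (fun i => (hξ i).stronglyMeasurable) n] g) :
    IndepFun g (ξ (n + 1)) μ := by
  rw [IndepFun_iff_Indep]
  exact indep_of_indep_of_le_left (hind.indep_comap_natural_of_lt
    (fun i => (hξ i).stronglyMeasurable) (Nat.lt_succ_self n)).symm hg.comap_le

theorem measurable_transform (hw0 : w 0 = 0)
    (hw : ∀ n, Measurable[Filtration.natural ξ (fun i => (hξ i).stronglyMeasurable) n] (w (n + 1)))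
    (n : ℕ) : Measurable[Filtration.natural ξ (fun i => (hξ i).stronglyMeasurable) n]
      (fun ω => ∑ k ∈ Finset.range (n + 1), w k ω * ξ k ω) := by
  set F := Filtration.natural ξ (fun i => (hξ i).stronglyMeasurable)
  refine Finset.measurable_fun_sum _ fun k hk => ?_
  rw [Finset.mem_range] at hk
  have h1 : Measurable[F n] (ξ k) :=
    ((Filtration.stronglyAdapted_natural (fun i => (hξ i).stronglyMeasurable) k).measurable).mono
      (F.mono (by omega)) le_rfl
  refine Measurable.mul ?_ h1
  cases k with
  | zero => rw [hw0]; exact measurable_const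
  | succ k => exact (hw k).mono (F.mono (by omega)) le_rfl

theorem memLp_transform_term (hL2 : ∀ i, MemLp (ξ i) 2 μ) (hw0 : w 0 = 0)
    (hw : ∀ n, Measurable[Filtration.natural ξ (fun i => (hξ i).stronglyMeasurable) n] (w (n + 1)))
    (hw1 : ∀ k ω, |w k ω| ≤ 1) (k : ℕ) : MemLp (fun ω => w k ω * ξ k ω) 2 μ := by
  set F := Filtration.natural ξ (fun i => (hξ i).stronglyMeasurable)
  have hwm : Measurable (w k) := by
    cases k with
    | zero => rw [hw0]; exact measurable_const
    | succ k => exact (hw k).mono (F.le k) le_rfl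
  refine (hL2 k).of_le (hwm.mul (hξ k)).aestronglyMeasurable (ae_of_all _ fun ω => ?_)
  rw [norm_mul]
  exact mul_le_of_le_one_left (norm_nonneg _) (hw1 k ω)

/-- The increments of a martingale transform are orthogonal to the past. -/
theorem setIntegral_transform_sq_succ (hind : iIndepFun ξ μ) (hL2 : ∀ i, MemLp (ξ i) 2 μ)
    (hmean : ∀ i, ∫ ω, ξ i ω ∂μ = 0) (hw0 : w 0 = 0)
    (hw : ∀ n, Measurable[Filtration.natural ξ (fun i => (hξ i).stronglyMeasurable) n] (w (n + 1)))
    (hw1 : ∀ k ω, |w k ω| ≤ 1) (n : ℕ) {s : Set Ω}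
    (hs : MeasurableSet[Filtration.natural ξ (fun i => (hξ i).stronglyMeasurable) n] s) :
    ∫ ω in s, (∑ k ∈ Finset.range (n + 2), w k ω * ξ k ω) ^ 2 ∂μ =
      ∫ ω in s, (∑ k ∈ Finset.range (n + 1), w k ω * ξ k ω) ^ 2 ∂μ +
        ∫ ω in s, (w (n + 1) ω * ξ (n + 1) ω) ^ 2 ∂μ := by
  set F := Filtration.natural ξ (fun i => (hξ i).stronglyMeasurable)
  set Z : Ω → ℝ := fun ω => ∑ k ∈ Finset.range (n + 1), w k ω * ξ k ω with hZ
  set d : Ω → ℝ := fun ω => w (n + 1) ω * ξ (n + 1) ω with hd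
  have hterm := memLp_transform_term hξ hL2 hw0 hw hw1
  have hZL : MemLp Z 2 μ := memLp_finsetSum _ fun k _ => hterm k
  have hdL : MemLp d 2 μ := hterm (n + 1)
  have hsm : MeasurableSet s := F.le n s hs
  have hZm := measurable_transform hξ hw0 hw n
  -- The indicator of `s`, `Z` and the predictable weight are all known at time `n`, hence
  -- independent of the centred `ξ (n + 1)`.
  have hcross : ∫ ω in s, Z ω * d ω ∂μ = 0 := by
    rw [← integral_indicator hsm]
    have hg : Measurable[F n] (s.indicator fun ω => Z ω * w (n + 1) ω) :=
      (hZm.mul (hw n)).indicator hs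
    have h1 : s.indicator (fun ω => Z ω * d ω) =
        fun ω => s.indicator (fun ω => Z ω * w (n + 1) ω) ω * ξ (n + 1) ω := by
      funext ω
      by_cases h : ω ∈ s
      · simp [h, hd, mul_assoc]
      · simp [h]
    rw [h1, (indepFun_of_measurable_natural hξ hind hg).integral_fun_mul_eq_mul_integral
      (hg.mono (F.le n) le_rfl).aestronglyMeasurable (hξ _).aestronglyMeasurable, hmean, mul_zero]
  have h2 : ∀ ω, (∑ k ∈ Finset.range (n + 2), w k ω * ξ k ω) ^ 2 =
      (Z ω ^ 2 + d ω ^ 2) + 2 * (Z ω * d ω) := by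
    intro ω
    rw [Finset.sum_range_succ]
    simp only [hZ, hd]
    ring
  simp only [h2]
  have hi1 : IntegrableOn (fun ω => Z ω ^ 2) s μ := hZL.integrable_sq.integrableOn
  have hi2 : IntegrableOn (fun ω => d ω ^ 2) s μ := hdL.integrable_sq.integrableOn
  have hi3 : IntegrableOn (fun ω => Z ω * d ω) s μ := (hZL.integrable_mul hdL).integrableOn
  have hi12 : IntegrableOn (fun ω => Z ω ^ 2 + d ω ^ 2) s μ := hi1.add hi2
  rw [integral_add hi12 (hi3.const_mul 2), integral_add hi1 hi2, integral_const_mul, hcross,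
    mul_zero, add_zero]

variable [IsProbabilityMeasure μ]

theorem submartingale_transform_sq (hind : iIndepFun ξ μ) (hL2 : ∀ i, MemLp (ξ i) 2 μ)
    (hmean : ∀ i, ∫ ω, ξ i ω ∂μ = 0) (hw0 : w 0 = 0)
    (hw : ∀ n, Measurable[Filtration.natural ξ (fun i => (hξ i).stronglyMeasurable) n] (w (n + 1)))
    (hw1 : ∀ k ω, |w k ω| ≤ 1) :
    Submartingale (fun n ω => (∑ k ∈ Finset.range (n + 1), w k ω * ξ k ω) ^ 2)
      (Filtration.natural ξ (fun i => (hξ i).stronglyMeasurable)) μ := by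
  refine submartingale_of_setIntegral_le_succ ?_ ?_ ?_
  · exact fun n => ((measurable_transform hξ hw0 hw n).pow_const 2).stronglyMeasurable
  · exact fun n => (memLp_finsetSum _ fun k _ =>
      memLp_transform_term hξ hL2 hw0 hw hw1 k).integrable_sq
  · intro n s hs
    rw [setIntegral_transform_sq_succ hξ hind hL2 hmean hw0 hw hw1 n hs]
    have : 0 ≤ ∫ ω in s, (w (n + 1) ω * ξ (n + 1) ω) ^ 2 ∂μ :=
      integral_nonneg fun ω => sq_nonneg _
    linarith

theorem integral_transform_sq (hind : iIndepFun ξ μ) (hL2 : ∀ i, MemLp (ξ i) 2 μ)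
    (hmean : ∀ i, ∫ ω, ξ i ω ∂μ = 0) {v : ℝ} (hvar : ∀ i, ∫ ω, ξ i ω ^ 2 ∂μ = v) (hw0 : w 0 = 0)
    (hw : ∀ n, Measurable[Filtration.natural ξ (fun i => (hξ i).stronglyMeasurable) n] (w (n + 1)))
    (hw1 : ∀ k ω, |w k ω| ≤ 1) (n : ℕ) :
    ∫ ω, (∑ k ∈ Finset.range (n + 1), w k ω * ξ k ω) ^ 2 ∂μ =
      v * ∫ ω, ∑ k ∈ Finset.range (n + 1), w k ω ^ 2 ∂μ := by
  set F := Filtration.natural ξ (fun i => (hξ i).stronglyMeasurable)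
  have hwm : ∀ k, Measurable (w k) := by
    intro k
    cases k with
    | zero => rw [hw0]; exact measurable_const
    | succ k => exact (hw k).mono (F.le k) le_rfl
  have hwi : ∀ k, Integrable (fun ω => w k ω ^ 2) μ := fun k =>
    (MemLp.of_bound (hwm k).aestronglyMeasurable 1 (ae_of_all _ (hw1 k))).integrable_sq
  induction n with
  | zero => simp [hw0]
  | succ n ih =>
    have h := setIntegral_transform_sq_succ hξ hind hL2 hmean hw0 hw hw1 n MeasurableSet.univ
    simp only [Measure.restrict_univ] at h
    rw [h, ih]
    have h1 : ∫ ω, (w (n + 1) ω * ξ (n + 1) ω) ^ 2 ∂μ = (∫ ω, w (n + 1) ω ^ 2 ∂μ) * v := by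
      rw [← hvar (n + 1)]
      simp only [mul_pow]
      exact ((indepFun_of_measurable_natural hξ hind (hw n)).comp (measurable_id.pow_const 2)
        (measurable_id.pow_const 2)).integral_fun_mul_eq_mul_integral
        ((hwm _).pow_const 2).aestronglyMeasurable ((hξ _).pow_const 2).aestronglyMeasurable
    simp only [Finset.sum_range_succ _ (n + 1)]
    rw [h1, integral_add (integrable_finsetSum _ fun k _ => hwi k) (hwi _)]
    ring

/-- Kolmogorov's maximal inequality for martingale transforms. -/
theorem measure_transform_ge_le (hind : iIndepFun ξ μ) (hL2 : ∀ i, MemLp (ξ i) 2 μ)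
    (hmean : ∀ i, ∫ ω, ξ i ω ∂μ = 0) {v : ℝ} (hv : 0 ≤ v) (hvar : ∀ i, ∫ ω, ξ i ω ^ 2 ∂μ = v)
    (hw0 : w 0 = 0)
    (hw : ∀ n, Measurable[Filtration.natural ξ (fun i => (hξ i).stronglyMeasurable) n] (w (n + 1)))
    (hw1 : ∀ k ω, |w k ω| ≤ 1) {R : ℝ} (hR : ∀ n ω, ∑ k ∈ Finset.range n, w k ω ^ 2 ≤ R)
    {η : ℝ} (hη : 0 < η) :
    μ {ω | ∃ n, η ≤ |∑ k ∈ Finset.range (n + 1), w k ω * ξ k ω|} ≤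
      ENNReal.ofReal (v * R / η ^ 2) := by
  set Z : ℕ → Ω → ℝ := fun n ω => ∑ k ∈ Finset.range (n + 1), w k ω * ξ k ω with hZ
  set E : ℕ → Set Ω := fun n => {ω | ∃ k ≤ n, η ≤ |Z k ω|} with hE
  have hEmono : Monotone E := fun a b hab ω ⟨k, hk, h⟩ => ⟨k, hk.trans hab, h⟩
  have hU : {ω | ∃ n, η ≤ |Z n ω|} = ⋃ n, E n := by
    ext ω
    simp only [hE, Set.mem_iUnion, Set.mem_ofPred_eq]
    exact ⟨fun ⟨n, h⟩ => ⟨n, n, le_rfl, h⟩, fun ⟨_, k, _, h⟩ => ⟨k, h⟩⟩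
  rw [hU]
  -- Doob's inequality for the squares bounds each finite horizon by the same constant, so the bound
  -- survives the increasing limit.
  refine le_of_tendsto' (tendsto_measure_iUnion_atTop hEmono) fun n => ?_
  have hsub := submartingale_transform_sq hξ hind hL2 hmean hw0 hw hw1
  have hmax := maximal_ineq hsub (fun n ω => sq_nonneg _) (ε := Real.toNNReal (η ^ 2)) n
  set s := {ω | (Real.toNNReal (η ^ 2) : ℝ) ≤
    (Finset.range (n + 1)).sup' Finset.nonempty_range_add_one fun k => Z k ω ^ 2}
  have hEs : E n ⊆ s := by
    rintro ω ⟨k, hk, h⟩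
    refine le_trans ?_ (Finset.le_sup' (fun k => Z k ω ^ 2) (Finset.mem_range.2 (by omega : k < n + 1)))
    rw [← sq_abs (Z k ω), Real.coe_toNNReal _ (sq_nonneg η)]
    exact pow_le_pow_left₀ hη.le h 2
  have hint : ∫ ω in s, Z n ω ^ 2 ∂μ ≤ v * R := by
    calc ∫ ω in s, Z n ω ^ 2 ∂μ ≤ ∫ ω, Z n ω ^ 2 ∂μ :=
          setIntegral_le_integral (hsub.integrable n) (ae_of_all _ fun ω => sq_nonneg _)
      _ = v * ∫ ω, ∑ k ∈ Finset.range (n + 1), w k ω ^ 2 ∂μ :=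
        integral_transform_sq hξ hind hL2 hmean hvar hw0 hw hw1 n
      _ ≤ v * R := by
        gcongr
        have hR0 : 0 ≤ R := by
          obtain ⟨ω⟩ : Nonempty Ω := by
            by_contra hne
            rw [not_nonempty_iff] at hne
            have := measure_univ (μ := μ)
            simp [Set.eq_empty_of_isEmpty] at this
          simpa using hR 0 ω
        refine (integral_mono_of_nonneg (ae_of_all _ fun ω => Finset.sum_nonneg fun _ _ =>
          sq_nonneg _) (integrable_const R) (ae_of_all _ (hR (n + 1)))).trans ?_
        simp
  have h1 : ENNReal.ofReal (η ^ 2) * μ (E n) ≤ ENNReal.ofReal (v * R) := by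
    refine le_trans ?_ (hmax.trans (ENNReal.ofReal_le_ofReal hint))
    change ENNReal.ofReal (η ^ 2) * _ ≤ ENNReal.ofReal (η ^ 2) * _
    gcongr
  have hη2 : 0 < η ^ 2 := by positivity
  rw [ENNReal.ofReal_div_of_pos hη2, ENNReal.le_div_iff_mul_le (Or.inl (by simpa using hη2.ne'))
    (Or.inl ENNReal.ofReal_ne_top), mul_comm]
  exact h1

end MartingaleTransform

/-! ### Self-normalized bounds for the noise correlations -/

/-- A weighted sum is controlled by the partial sums of its self-normalized terms. -/
theorem abs_sum_mul_le_of_normalized {u x : ℕ → ℝ} {A η : ℝ} (hA : 0 < A)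
    (h : ∀ n, |∑ k ∈ Finset.range n, u k / (A + ∑ i ∈ Finset.range (k + 1), u i ^ 2) * x k| ≤ η)
    (n : ℕ) : |∑ k ∈ Finset.range n, u k * x k| ≤
      2 * η * (A + ∑ k ∈ Finset.range n, u k ^ 2) := by
  set V : ℕ → ℝ := fun n => A + ∑ k ∈ Finset.range n, u k ^ 2 with hV
  have hV0 : ∀ n, 0 < V n := fun n =>
    add_pos_of_pos_of_nonneg hA (Finset.sum_nonneg fun _ _ => sq_nonneg _)
  have hVs : ∀ n, V (n + 1) = V n + u n ^ 2 := fun n => by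
    simp only [hV, Finset.sum_range_succ]; ring
  set Z : ℕ → ℝ := fun n => ∑ k ∈ Finset.range n, u k / V (k + 1) * x k with hZ
  set T : ℕ → ℝ := fun n => ∑ k ∈ Finset.range n, u k * x k with hT
  have hη : 0 ≤ η := (abs_nonneg _).trans (h 0)
  -- Summation by parts: `T n - V n * Z n` equals `-∑ k < n, u k ^ 2 * Z k`.
  have key : |T n - V n * Z n| ≤ η * V n := by
    induction n with
    | zero => simp only [hT, hZ, Finset.sum_range_zero, mul_zero, sub_zero, abs_zero]
              exact mul_nonneg hη (hV0 0).le
    | succ n ih =>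
      have h1 : T (n + 1) - V (n + 1) * Z (n + 1) = (T n - V n * Z n) - u n ^ 2 * Z n := by
        simp only [hT, hZ, Finset.sum_range_succ]
        rw [mul_add, ← mul_assoc (V (n + 1)) (u n / V (n + 1)), mul_div_cancel₀ _ (hV0 _).ne', hVs]
        ring
      rw [h1, hVs]
      refine (abs_sub _ _).trans ?_
      rw [abs_mul, abs_of_nonneg (sq_nonneg (u n))]
      have := mul_le_mul_of_nonneg_left (h n) (sq_nonneg (u n))
      linarith
  have h2 : |V n * Z n| ≤ η * V n := by
    rw [abs_mul, abs_of_pos (hV0 n), mul_comm]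
    exact mul_le_mul_of_nonneg_right (h n) (hV0 n).le
  calc |T n| = |(T n - V n * Z n) + V n * Z n| := by congr 1; ring
    _ ≤ _ := abs_add_le _ _
    _ ≤ η * V n + η * V n := add_le_add key h2
    _ = _ := by ring

/-- With `V` the running denominator, `u² / V_{k+1}² ≤ u² / (V_k V_{k+1}) = 1/V_k - 1/V_{k+1}`,
which telescopes. -/
theorem sum_normalized_sq_le (u : ℕ → ℝ) {A : ℝ} (hA : 0 < A) (n : ℕ) :
    ∑ k ∈ Finset.range n, (u k / (A + ∑ i ∈ Finset.range (k + 1), u i ^ 2)) ^ 2 ≤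
      1 / A - 1 / (A + ∑ k ∈ Finset.range n, u k ^ 2) := by
  induction n with
  | zero => simp
  | succ n ih =>
    rw [Finset.sum_range_succ]
    set V := A + ∑ k ∈ Finset.range n, u k ^ 2 with hV
    have hV0 : 0 < V := add_pos_of_pos_of_nonneg hA (Finset.sum_nonneg fun _ _ => sq_nonneg _)
    have hVs : A + ∑ k ∈ Finset.range (n + 1), u k ^ 2 = V + u n ^ 2 := by
      rw [Finset.sum_range_succ, hV]; ring
    rw [hVs]
    have hV1 : 0 < V + u n ^ 2 := by positivity
    have h1 : (u n / (V + u n ^ 2)) ^ 2 ≤ 1 / V - 1 / (V + u n ^ 2) := by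
      have : 1 / V - 1 / (V + u n ^ 2) = u n ^ 2 / (V * (V + u n ^ 2)) := by
        field_simp
        ring
      rw [this, div_pow, sq (V + u n ^ 2)]
      gcongr
      linarith [sq_nonneg (u n)]
    linarith

theorem measurable_ar {Ω : Type*} {m : MeasurableSpace Ω} {p : ℕ} (θ : Fin p → ℝ) {ε : ℕ → Ω → ℝ}
    {N : ℕ} (h : ∀ i, 1 ≤ i → i ≤ N → Measurable (ε i)) {n : ℤ} (hn : n ≤ N) :
    Measurable fun ω => ar θ (fun k => ε k ω) n := by
  have key : ∀ n : ℕ, n ≤ N → Measurable fun ω => arNat θ (fun k => ε k ω) n := by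
    intro n
    induction n using Nat.strong_induction_on with
    | _ n ih =>
      intro hn
      cases n with
      | zero => simp only [arNat]; exact measurable_const
      | succ n =>
        simp only [arNat]
        refine (Finset.measurable_fun_sum _ fun l _ => ?_).add (h _ (by omega) hn)
        exact (ih (n - l) (by omega) (by omega)).const_mul _
  exact key _ (by omega)

/-- A self-normalized maximal inequality for the correlations of the process with the noise. -/
theorem measure_correlation_le {Ω : Type*} [MeasurableSpace Ω] {μ : Measure Ω}
    [IsProbabilityMeasure μ] {ε : ℕ → Ω → ℝ} (hmeas : ∀ n : ℕ, 1 ≤ n → Measurable (ε n))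
    (hindep : iIndepFun (fun n : ℕ => ε (n + 1)) μ) (hL2 : ∀ i, MemLp (ε (i + 1)) 2 μ)
    (hmean : ∀ i, ∫ ω, ε (i + 1) ω ∂μ = 0) {v : ℝ} (hv : 0 ≤ v)
    (hvar : ∀ i, ∫ ω, ε (i + 1) ω ^ 2 ∂μ = v) {p : ℕ} (θ : Fin p → ℝ) {j : ℕ} (hj : 1 ≤ j)
    {A η : ℝ} (hA : 1 ≤ A) (hη : 0 < η) :
    μ {ω | ∃ n : ℕ, 2 * η * (A + sumSq θ (fun k => ε k ω) n) <
        |∑ k ∈ Finset.Icc 1 n, ar θ (fun k => ε k ω) ((k : ℤ) - j) * ε k ω|} ≤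
      ENNReal.ofReal (v / (A * η ^ 2)) := by
  have hA0 : 0 < A := by linarith
  set ξ : ℕ → Ω → ℝ := fun n => ε (n + 1) with hξd
  have hξ : ∀ i, Measurable (ξ i) := fun i => hmeas (i + 1) (by omega)
  set F := Filtration.natural ξ (fun i => (hξ i).stronglyMeasurable) with hF
  set u : ℕ → Ω → ℝ := fun k ω => ar θ (fun k => ε k ω) (((k + 1 : ℕ) : ℤ) - j) with hu
  set w : ℕ → Ω → ℝ := fun k ω => u k ω / (A + ∑ i ∈ Finset.range (k + 1), u i ω ^ 2) with hw
  have hu0 : u 0 = 0 := by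
    funext ω
    exact ar_nonpos θ _ (by push_cast; omega)
  have hw0 : w 0 = 0 := by
    funext ω
    simp only [hw, hu0, Pi.zero_apply, zero_div]
  -- Predictability rests on `1 ≤ j`: `u k` is `x_{k+1-j}`, which involves the noise up to `ε k = ξ
  -- (k - 1)` at most.
  have hum : ∀ n k, k ≤ n + 1 → Measurable[F n] (u k) := by
    intro n k hk
    refine measurable_ar (m := F n) θ (N := n + 1) (fun i hi hin => ?_) (by push_cast; omega)
    have h1 := ((Filtration.stronglyAdapted_natural (fun i => (hξ i).stronglyMeasurable)
      (i - 1)).measurable).mono (F.mono (by omega : i - 1 ≤ n)) le_rfl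
    have h2 : ξ (i - 1) = ε i := by simp only [hξd]; rw [Nat.sub_add_cancel hi]
    rwa [h2] at h1
  have hwm : ∀ n, Measurable[F n] (w (n + 1)) := by
    intro n
    refine (hum n (n + 1) le_rfl).div (measurable_const.add ?_)
    refine Finset.measurable_fun_sum _ fun i hi => (hum n i ?_).pow_const 2
    rw [Finset.mem_range] at hi
    omega
  -- Here `1 ≤ A` matters: `|u| ≤ 1 + u²`.
  have hw1 : ∀ k ω, |w k ω| ≤ 1 := by
    intro k ω
    simp only [hw]
    have h1 : 0 ≤ ∑ i ∈ Finset.range k, u i ω ^ 2 := Finset.sum_nonneg fun _ _ => sq_nonneg _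
    have h2 : 0 < A + (∑ i ∈ Finset.range k, u i ω ^ 2 + u k ω ^ 2) := by positivity
    rw [Finset.sum_range_succ, abs_div, abs_of_pos h2, div_le_one h2, ← sq_abs (u k ω)]
    nlinarith [sq_nonneg (|u k ω| - 1), abs_nonneg (u k ω)]
  have hR : ∀ n ω, ∑ k ∈ Finset.range n, w k ω ^ 2 ≤ 1 / A := by
    intro n ω
    refine (sum_normalized_sq_le (fun k => u k ω) hA0 n).trans ?_
    have : 0 ≤ ∑ k ∈ Finset.range n, u k ω ^ 2 := Finset.sum_nonneg fun _ _ => sq_nonneg _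
    have : 0 < 1 / (A + ∑ k ∈ Finset.range n, u k ω ^ 2) := by positivity
    linarith
  have hmax := measure_transform_ge_le hξ hindep hL2 hmean hv hvar hw0 hwm hw1 hR hη
  have hconst : v * (1 / A) / η ^ 2 = v / (A * η ^ 2) := by field_simp
  rw [hconst] at hmax
  refine (measure_mono ?_).trans hmax
  intro ω hω
  obtain ⟨n, hn⟩ := hω
  by_contra hcon
  simp only [Set.mem_ofPred_eq, not_exists, not_le] at hcon
  have h1 := abs_sum_mul_le_of_normalized (u := fun k => u k ω) (x := fun k => ξ k ω) hA0
    (η := η) (by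
      intro n
      cases n with
      | zero => simpa using hη.le
      | succ n => exact (hcon n).le) n
  have h2 : ∑ k ∈ Finset.Icc 1 n, ar θ (fun k => ε k ω) ((k : ℤ) - j) * ε k ω =
      ∑ k ∈ Finset.range n, u k ω * ξ k ω := by
    rw [Finset.range_eq_Ico, Finset.sum_Ico_add'
      (fun k : ℕ => ar θ (fun k => ε k ω) ((k : ℤ) - j) * ε k ω) 0 n 1]
    rfl
  have h3 : ∑ k ∈ Finset.range n, u k ω ^ 2 ≤ sumSq θ (fun k => ε k ω) n := by
    refine le_trans (le_of_eq ?_) (sum_lag_sq_le θ (fun k => ε k ω) n hj)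
    rw [Finset.range_eq_Ico, Finset.sum_Ico_add'
      (fun k : ℕ => ar θ (fun k => ε k ω) ((k : ℤ) - j) ^ 2) 0 n 1]
    rfl
  rw [h2] at hn
  have h4 : 2 * η * (A + ∑ k ∈ Finset.range n, u k ω ^ 2) ≤
      2 * η * (A + sumSq θ (fun k => ε k ω) n) := by gcongr
  linarith

/-! ### Law of large numbers and conclusion -/

/-- The strong law of large numbers for the squared noise, as convergence in probability of the
tail suprema. -/
theorem tendsto_measure_noise_energy {Ω : Type*} [MeasurableSpace Ω] {μ : Measure Ω}
    [IsProbabilityMeasure μ] {ε : ℕ → Ω → ℝ} (hmeas : ∀ n : ℕ, 1 ≤ n → Measurable (ε n))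
    (hindep : iIndepFun (fun n : ℕ => ε (n + 1)) μ)
    (hident : ∀ n : ℕ, 1 ≤ n → IdentDistrib (ε n) (ε 1) μ μ) (hL2 : MemLp (ε 1) 2 μ) {v : ℝ}
    (hvar : ∫ ω, (ε 1 ω) ^ 2 ∂μ = v) {τ : ℝ} (hτ : 0 < τ) :
    Tendsto (fun m : ℕ => μ {ω | ¬ ∀ n, m ≤ n →
      |∑ k ∈ Finset.Icc 1 n, ε k ω ^ 2 - v * n| ≤ τ * n}) atTop (𝓝 0) := by
  have hsq : Measurable fun x : ℝ => x ^ 2 := measurable_id.pow_const 2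
  have hslln := strong_law_ae_real (μ := μ) (fun i ω => ε (i + 1) ω ^ 2) hL2.integrable_sq
    (fun i j hij => (hindep.indepFun hij).comp hsq hsq)
    (fun i => (hident (i + 1) (by omega)).comp hsq)
  simp only [zero_add, hvar] at hslln
  have hsum : ∀ (n : ℕ) (ω : Ω), ∑ i ∈ Finset.range n, ε (i + 1) ω ^ 2 =
      ∑ k ∈ Finset.Icc 1 n, ε k ω ^ 2 := by
    intro n ω
    rw [Finset.range_eq_Ico, Finset.sum_Ico_add' (fun k : ℕ => ε k ω ^ 2) 0 n 1]
    rfl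
  set s : ℕ → Set Ω := fun m => {ω | ¬ ∀ n, m ≤ n →
      |∑ k ∈ Finset.Icc 1 n, ε k ω ^ 2 - v * n| ≤ τ * n} with hs
  have hsm : ∀ m, MeasurableSet (s m) := by
    intro m
    refine MeasurableSet.compl (s := {ω | ∀ n, m ≤ n →
      |∑ k ∈ Finset.Icc 1 n, ε k ω ^ 2 - v * n| ≤ τ * n}) ?_
    simp only [Set.ofPred_forall]
    refine MeasurableSet.iInter fun n => MeasurableSet.iInter fun _ => ?_
    refine measurableSet_le (Measurable.abs (Measurable.sub_const ?_ _)) measurable_const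
    exact Finset.measurable_fun_sum _ fun k hk =>
      (hmeas k (Finset.mem_Icc.1 hk).1).pow_const 2
  have hanti : Antitone s := fun a b hab ω h h' => h fun n hn => h' n (hab.trans hn)
  have hnull : μ (⋂ m, s m) = 0 := by
    refine measure_mono_null ?_ hslln
    intro ω hω hlim
    obtain ⟨N, hN⟩ := Metric.tendsto_atTop.1 hlim τ hτ
    -- `N + 1` rather than `N` keeps `n` positive for the division.
    refine Set.mem_iInter.1 hω (N + 1) fun n hn => ?_
    have h1 := (hN n (by omega)).le
    have hn0 : (0 : ℝ) < n := by exact_mod_cast (by omega : 0 < n)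
    rw [Real.dist_eq, hsum, div_sub' hn0.ne', abs_div, abs_of_pos hn0, div_le_iff₀ hn0,
      mul_comm (n : ℝ)] at h1
    exact h1
  have := tendsto_measure_iInter_atTop (fun m => (hsm m).nullMeasurableSet) hanti
    ⟨0, measure_ne_top μ _⟩
  rwa [hnull] at this

end ARModel

/-- The noise `ε_1, ε_2, …` is i.i.d., centred, with variance `σ² ∈ (0, ∞)` and a law not
depending on `θ`; the probability under `θ` of an event of the process is the probability of that
event for the process that the noise drives with parameter `θ`. -/
theorem lemma3p3 {Ω : Type*} [MeasurableSpace Ω] (μ : Measure Ω) [IsProbabilityMeasure μ]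
    (ε : ℕ → Ω → ℝ)
    (hmeas : ∀ n : ℕ, 1 ≤ n → Measurable (ε n))
    (hindep : iIndepFun (fun n : ℕ => ε (n + 1)) μ)
    (hident : ∀ n : ℕ, 1 ≤ n → IdentDistrib (ε n) (ε 1) μ μ)
    (hL2 : MemLp (ε 1) 2 μ)
    (hmean : ∫ ω, ε 1 ω ∂μ = 0)
    (σ : ℝ) (hσ : 0 < σ)
    (hvar : ∫ ω, (ε 1 ω) ^ 2 ∂μ = σ ^ 2)
    (p : ℕ) (hp : 1 ≤ p)
    (K : Set (Fin p → ℝ)) (hK : IsCompact K) (hKsub : K ⊆ ARModel.tildeLambda p)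
    (δ : ℝ) (hδ : 0 < δ) :
    Tendsto
      (fun m : ℕ => ⨆ θ ∈ K,
        μ {ω | ∃ n : ℕ, m ≤ n ∧
          δ ≤ ‖(ARModel.sumSq θ (fun k => ε k ω) n)⁻¹ • ARModel.fisher θ (fun k => ε k ω) n
                - ARModel.limitMatrix θ‖})
      atTop (𝓝 0) := by
  have hσ2 : 0 < σ ^ 2 := by positivity
  obtain ⟨t, ht, hmat⟩ := ARModel.exists_norm_sub_limitMatrix_lt hK
    (fun θ hθ => (hKsub hθ).2.2.1) hδ
  obtain ⟨c, hc, hgrowth⟩ := ARModel.exists_sumSq_bounds hp hK (fun θ hθ => (hKsub hθ).1)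
    (fun θ hθ => (hKsub hθ).2.1) hσ2
  obtain ⟨τ, hτ, N, hN⟩ := hgrowth t ht
  have hsq : Measurable fun x : ℝ => x ^ 2 := measurable_id.pow_const 2
  have hL2' : ∀ i, MemLp (ε (i + 1)) 2 μ := fun i => (hident (i + 1) (by omega)).memLp_iff.2 hL2
  have hmean' : ∀ i, ∫ ω, ε (i + 1) ω ∂μ = 0 := fun i => by
    rw [(hident (i + 1) (by omega)).integral_eq, hmean]
  have hvar' : ∀ i, ∫ ω, ε (i + 1) ω ^ 2 ∂μ = σ ^ 2 := fun i => by
    rw [← hvar]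
    exact ((hident (i + 1) (by omega)).comp hsq).integral_eq
  rw [ENNReal.tendsto_nhds_zero]
  intro α hα
  obtain ⟨r, hr0, hrα⟩ := ENNReal.lt_iff_exists_nnreal_btwn.1 hα
  have hr : (0 : ℝ) < r := by exact_mod_cast hr0
  set η := t / 4 with hη
  have hη0 : 0 < η := by positivity
  -- `A` brings the total probability of the correlation events below `r / 2`. Once `A ≤ sumSq`, the
  -- choice `η = t / 4` turns `2 * η * (A + sumSq)` into at most `t * sumSq`.
  set A : ℝ := 1 + 2 * p * σ ^ 2 / (r * η ^ 2) with hA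
  have hA1 : 1 ≤ A := by
    have : 0 ≤ 2 * p * σ ^ 2 / (r * η ^ 2) := by positivity
    linarith
  have hA0 : 0 < A := by linarith
  have hAr : p * (σ ^ 2 / (A * η ^ 2)) ≤ r / 2 := by
    have h1 : 2 * p * σ ^ 2 / (r * η ^ 2) ≤ A := by linarith
    rw [div_le_iff₀ (by positivity)] at h1
    rw [mul_div_assoc', div_le_iff₀ (by positivity)]
    linarith
  obtain ⟨n₁, hn₁⟩ := exists_nat_ge (A / c)
  rw [div_le_iff₀ hc] at hn₁
  have hnoise := ARModel.tendsto_measure_noise_energy hmeas hindep hident hL2 hvar hτ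
  obtain ⟨m₀, hm₀⟩ := (ENNReal.tendsto_nhds_zero.1 hnoise (ENNReal.ofReal (r / 2))
    (ENNReal.ofReal_pos.2 (by positivity))).exists
  filter_upwards [eventually_ge_atTop (m₀ + N + n₁ + p)] with m hm
  refine iSup₂_le fun θ hθ => le_trans ?_ hrα.le
  -- `G` does not involve `θ`, and the events `T j` do but have bounds free of it; hence the
  -- supremum over `K` costs nothing.
  set G : Set Ω := {ω | ¬ ∀ n, m₀ ≤ n →
    |∑ k ∈ Finset.Icc 1 n, ε k ω ^ 2 - σ ^ 2 * n| ≤ τ * n} with hG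
  set T : ℕ → Set Ω := fun j => {ω | ∃ n : ℕ,
    2 * η * (A + ARModel.sumSq θ (fun k => ε k ω) n) <
      |∑ k ∈ Finset.Icc 1 n, ARModel.ar θ (fun k => ε k ω) ((k : ℤ) - j) * ε k ω|} with hT
  have hsub : {ω | ∃ n : ℕ, m ≤ n ∧
      δ ≤ ‖(ARModel.sumSq θ (fun k => ε k ω) n)⁻¹ • ARModel.fisher θ (fun k => ε k ω) n
        - ARModel.limitMatrix θ‖} ⊆ G ∪ ⋃ j ∈ Finset.Icc 1 (p - 1), T j := by
    rintro ω ⟨n, hn, hbad⟩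
    by_contra hcon
    simp only [Set.mem_union, Set.mem_iUnion, not_or, not_exists] at hcon
    obtain ⟨hωG, hωT⟩ := hcon
    have hgood := hN (fun k => ε k ω) m₀ (not_not.1 hωG) θ hθ
    have hAS : A ≤ ARModel.sumSq θ (fun k => ε k ω) n := by
      refine le_trans ?_ (hgood n (by omega)).1
      have : (n₁ : ℝ) ≤ n := by exact_mod_cast (by omega : n₁ ≤ n)
      nlinarith
    refine absurd hbad (not_le.2 (hmat θ hθ (fun k => ε k ω) n (by linarith) ?_ ?_))
    · intro i hi
      have h1 := (hgood (n - i) (by omega)).2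
      rw [Nat.cast_sub (by omega)] at h1
      exact h1.trans (mul_le_mul_of_nonneg_left
        (ARModel.sumSq_mono θ _ (Nat.sub_le n i)) ht.le)
    · intro j hj
      have h1 : ¬ 2 * η * (A + ARModel.sumSq θ (fun k => ε k ω) n) <
          |∑ k ∈ Finset.Icc 1 n, ARModel.ar θ (fun k => ε k ω) ((k : ℤ) - j) * ε k ω| :=
        fun h => hωT j hj ⟨n, h⟩
      rw [not_lt] at h1
      refine h1.trans ?_
      rw [hη]
      nlinarith
  have hTj : ∀ j ∈ Finset.Icc 1 (p - 1), μ (T j) ≤ ENNReal.ofReal (σ ^ 2 / (A * η ^ 2)) :=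
    fun j hj => ARModel.measure_correlation_le hmeas hindep hL2' hmean' hσ2.le hvar' θ
      (Finset.mem_Icc.1 hj).1 hA1 hη0
  calc _ ≤ μ (G ∪ ⋃ j ∈ Finset.Icc 1 (p - 1), T j) := measure_mono hsub
    _ ≤ μ G + ∑ j ∈ Finset.Icc 1 (p - 1), μ (T j) :=
      (measure_union_le _ _).trans (add_le_add le_rfl (measure_biUnion_finset_le _ _))
    _ ≤ ENNReal.ofReal (r / 2) + ∑ j ∈ Finset.Icc 1 (p - 1),
        ENNReal.ofReal (σ ^ 2 / (A * η ^ 2)) := add_le_add hm₀ (Finset.sum_le_sum hTj)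
    _ ≤ ENNReal.ofReal (r / 2) + ENNReal.ofReal (r / 2) := by
      gcongr
      rw [← ENNReal.ofReal_sum_of_nonneg fun _ _ => by positivity]
      refine ENNReal.ofReal_le_ofReal (le_trans ?_ hAr)
      rw [Finset.sum_const, nsmul_eq_mul, Nat.card_Icc]
      gcongr
      omega
    _ = r := by
      rw [← ENNReal.ofReal_add (by positivity) (by positivity), add_halves,
        ENNReal.ofReal_coe_nnreal]
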